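/- Let $\Bbbk$ be a commutative ring and let $\Lambda'$ be the free associative $\Bbbk$-algebra on generators $h_1,h_2,\dots$, with $h_0=1$ and $\deg h_n=n$. For a composition $\alpha=(a_1,\dots,a_r)$ put $h_\alpha=h_{a_1}\cdots h_{a_r}$, $|\alpha|=a_1+\dots+a_r$, and let $S_\alpha=S_{a_1}\times\dots\times S_{a_r}\subseteq S_{|\alpha|}$ be the parabolic subgroup. Define a symmetric bilinear form on $\Lambda'$ by $$(h_\beta,h_\alpha)=\sum_{c\in S_\beta\backslash S_n/S_\alpha}(-1)^{\ell(c)}\quad\text{if }|\alpha|=|\beta|=n,\qquad (h_\beta,h_\alpha)=0\quad\text{if }|\alpha|\neq|\beta|,$$ where $\ell(c)$ is the smallest Coxeter length of an element of the double coset $c$. Let $\Lambda=\Lambda'/\mathcal I$, where $\mathcal I$ is the radical of the form, with the induced form $(\cdot,\cdot)$, and let $\Lambda_n\subseteq\Lambda$ be the part of degree $n$. For a partition $\lambda=(\lambda_1,\lambda_2,\dots,\lambda_r)$ let $h_\lambda\in\Lambda$ be the class of $h_{\lambda_1}h_{\lambda_2}\cdots h_{\lambda_r}$. For a semistandard Young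 tableau $T$ let $\mathrm{sign}(T)=(-1)^{\ell}$, where $\ell$ is the length of a minimal length permutation that sorts into non-decreasing order the row word of $T$ (entries read from left to right, bottom row to top row). For partitions $\lambda,\mu$ of $n$ the odd Kostka number is $$K_{\lambda\mu}=\mathrm{sign}(T_\lambda)\sum_T\mathrm{sign}(T),$$ the sum over semistandard Young tableaux $T$ of shape $\lambda$ and content $\mu$, where $T_\lambda$ is the unique one of shape and content $\lambda$. For a partition $\lambda$ let $\langle\lambda\rangle=\sum_i\tfrac12\lambda_i(\lambda_i+1)$, and let $\lambda^T$ be the transpose of $\lambda$. There is exactly one family $(s_\lambda)$ in $\Lambda$, indexed by all partitions (the odd Schur functions), such that $$h_\mu=\sum_{\lambda\vdash n}K_{\lambda\mu}s_\lambda\qquad\text{for all }n\ge 0\text{ and }\mu\vdash n,$$ and exactly one family $(m_\lambda)$ (the odd monomial functions) with $m_\lambda\in\Lambda_{|\lambda|}$ such that $(h_\lambda,m_\mu)=\delta_{\lambda\mu}$ for all $n\ge0$ and $\lambda,\mu\vdash n$. The odd Schur functions are signed-orthonormal: $$(s_\lambda,s_\mu)=(-1)^{\langle\lambda^T\rangle+|\lambda|}\,\delta_{\lambda\mu}\qquad\text{for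 all partitions }\lambda,\mu,$$ and in terms of the odd monomial functions they are given, for all $n\ge 0$ and $\lambda\vdash n$, by $$(-1)^{\langle\lambda^T\rangle+|\lambda|}s_\lambda=\sum_{\mu\vdash n}K_{\lambda\mu}m_\mu.$$ -/

import Mathlib

namespace OddSym

/-! ### Permutations, parabolic subgroups and double cosets -/

/-- The Coxeter length of a permutation: the number of pairs `i < j` with `σ i > σ j`. -/
def permLength {n : ℕ} (σ : Equiv.Perm (Fin n)) : ℕ :=
  (Finset.univ.filter fun p : Fin n × Fin n => p.1 < p.2 ∧ σ p.2 < σ p.1).card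

/-- Positions `0, 1, 2, …` are cut into consecutive blocks ("platforms") of sizes `a₁, a₂, …`;
`blockOf [a₁, a₂, …] i` is the (zero-based) number of the block that contains position `i`. -/
def blockOf : List ℕ → ℕ → ℕ
  | [], _ => 0
  | a :: l, i => if i < a then 0 else blockOf l (i - a) + 1

/-- The parabolic subgroup `S_α = S_{a₁} × S_{a₂} × ⋯` of `S_n`: the permutations
that map every block of `α` to itself. It is used for `n = |α|`. -/
def parabolic (n : ℕ) (α : List ℕ) : Subgroup (Equiv.Perm (Fin n)) where
  carrier := {σ | ∀ i, blockOf α (σ i) = blockOf α i}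
  mul_mem' := by
    intro σ τ hσ hτ i
    exact (hσ (τ i)).trans (hτ i)
  one_mem' := fun _ => rfl
  inv_mem' := by
    intro σ hσ i
    have h := hσ (σ⁻¹ i)
    have e : σ (σ⁻¹ i) = i := σ.apply_symm_apply i
    rw [e] at h
    exact h.symm

/-- The set of double cosets `S_β \ S_n / S_α`. -/
abbrev Cosets (n : ℕ) (β α : List ℕ) : Type :=
  DoubleCoset.Quotient (parabolic n β : Set (Equiv.Perm (Fin n)))
    (parabolic n α : Set (Equiv.Perm (Fin n)))

noncomputable instance (n : ℕ) (β α : List ℕ) : Fintype (Cosets n β α) :=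
  haveI : Finite (Cosets n β α) := Quotient.finite _
  Fintype.ofFinite _

/-- The length `ℓ(c)` of a double coset: the least length of its elements. -/
noncomputable def cosetLength {n : ℕ} {β α : List ℕ} (c : Cosets n β α) : ℕ :=
  sInf (permLength '' {σ | DoubleCoset.mk (parabolic n β) (parabolic n α) σ = c})

/-- The number `(h_β, h_α) = ∑_c (-1)^{ℓ(c)}`, the sum over `c ∈ S_β \ S_n / S_α`, if
`|α| = |β| = n`, and `0` if `|α| ≠ |β|`. -/
noncomputable def pairing (β α : List ℕ) : ℤ :=
  if β.sum = α.sum then ∑ c : Cosets α.sum β α, (-1) ^ cosetLength c else 0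

/-! ### Odd symmetric functions -/

section Algebra

variable (k : Type*) [CommRing k]

/-- The free associative algebra `Λ'` on generators `h₁, h₂, …`. -/
abbrev FreeSym : Type _ := FreeAlgebra k ℕ+

/-- The element `h_n` of `Λ'`, with `h₀ = 1`. -/
def hFree (n : ℕ) : FreeSym k :=
  if hn : 0 < n then FreeAlgebra.ι k (⟨n, hn⟩ : ℕ+) else 1

/-- The product `h_α = h_{a₁} h_{a₂} ⋯` in `Λ'`. -/
def hFreeProd (α : List ℕ) : FreeSym k := (α.map (hFree k)).prod

/-- The bilinear form on `Λ'`, defined on its basis of all words in `h₁, h₂, …`. -/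
noncomputable def freeForm : FreeSym k →ₗ[k] FreeSym k →ₗ[k] k :=
  (FreeAlgebra.basisFreeMonoid k ℕ+).constr k fun β =>
    (FreeAlgebra.basisFreeMonoid k ℕ+).constr k fun α =>
      ((pairing ((FreeMonoid.toList β).map PNat.val)
        ((FreeMonoid.toList α).map PNat.val) : ℤ) : k)

theorem basis_eq_hFreeProd (α : FreeMonoid ℕ+) :
    FreeAlgebra.basisFreeMonoid k ℕ+ α
      = hFreeProd k ((FreeMonoid.toList α).map PNat.val) := by
  have h1 : FreeAlgebra.basisFreeMonoid k ℕ+ α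
      = FreeMonoid.lift (FreeAlgebra.ι k) α := by
    simp [FreeAlgebra.basisFreeMonoid, FreeAlgebra.equivMonoidAlgebraFreeMonoid]
  rw [h1, FreeMonoid.lift_apply, hFreeProd, List.map_map]
  congr 1
  apply List.map_congr_left
  intro a _
  simp [hFree, a.pos]
  rfl

/-- The values of the form on products of the generators. -/
theorem freeForm_hFreeProd (β α : List ℕ+) :
    freeForm k (hFreeProd k (β.map PNat.val)) (hFreeProd k (α.map PNat.val))
      = ((pairing (β.map PNat.val) (α.map PNat.val) : ℤ) : k) := by
  have hb := basis_eq_hFreeProd k (FreeMonoid.ofList β)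
  have ha := basis_eq_hFreeProd k (FreeMonoid.ofList α)
  rw [FreeMonoid.toList_ofList] at hb ha
  rw [← hb, ← ha, freeForm, Module.Basis.constr_basis, Module.Basis.constr_basis,
    FreeMonoid.toList_ofList, FreeMonoid.toList_ofList]

/-- The radical of the form on `Λ'`. The form is symmetric, so that its left and right kernels
coincide; the radical is written here as their intersection. -/
noncomputable def radical : Submodule k (FreeSym k) :=
  LinearMap.ker (freeForm k) ⊓ LinearMap.ker (freeForm k).flip

/-- The `k`-module `Λ` of odd symmetric functions: the quotient of `Λ'` by the radical. -/
abbrev OddSymFun : Type _ := FreeSym k ⧸ radical k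

/-- The bilinear form `( , )` on `Λ`, induced by the form on `Λ'`. -/
noncomputable def form : OddSymFun k →ₗ[k] OddSymFun k →ₗ[k] k :=
  (radical k).liftQ
    ((radical k).liftQ (freeForm k).flip inf_le_right).flip (by
      intro x hx
      rw [LinearMap.mem_ker]
      apply LinearMap.ext
      intro y
      obtain ⟨y, rfl⟩ := Submodule.Quotient.mk_surjective _ y
      have h : freeForm k x = 0 := hx.1
      change freeForm k x y = 0
      rw [h, LinearMap.zero_apply])

theorem form_mk (x y : FreeSym k) :
    form k (Submodule.Quotient.mk x) (Submodule.Quotient.mk y) = freeForm k x y := rfl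

/-- The product `h_α = h_{a₁} h_{a₂} ⋯`, as an element of `Λ`. -/
noncomputable def hProd (α : List ℕ) : OddSymFun k := Submodule.Quotient.mk (hFreeProd k α)

/-- The homogeneous part `Λ_n` of degree `n`: the span of the products `h_α` with `|α| = n`. -/
noncomputable def homogeneous (n : ℕ) : Submodule k (OddSymFun k) :=
  Submodule.span k {x | ∃ α : List ℕ, α.sum = n ∧ x = hProd k α}

/-- The odd complete symmetric function `h_λ = h_{λ₁} h_{λ₂} ⋯` of a partition `λ`. -/
noncomputable def complete (lam : YoungDiagram) : OddSymFun k := hProd k lam.rowLens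

end Algebra

/-! ### Odd Kostka numbers -/

instance : DecidableEq YoungDiagram := fun _ _ =>
  decidable_of_iff _ YoungDiagram.ext_iff.symm

theorem finite_partitions (n : ℕ) : {lam : YoungDiagram | lam.card = n}.Finite := by
  have hinj : Function.Injective YoungDiagram.cells := fun a b h => YoungDiagram.ext h
  refine Set.Finite.of_finite_image
    (f := YoungDiagram.cells) (Set.Finite.subset
      (Finset.finite_toSet (Finset.range n ×ˢ Finset.range n).powerset) ?_) hinj.injOn
  rintro _ ⟨lam, hlam, rfl⟩
  have hlam' : lam.cells.card = n := hlam
  simp only [Finset.coe_powerset, Set.mem_preimage, Set.mem_powerset_iff]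
  rintro ⟨i, j⟩ hij
  have hij' : (i, j) ∈ lam := hij
  have h1 : lam.rowLen i ≤ n := by
    rw [YoungDiagram.rowLen_eq_card, ← hlam']
    exact Finset.card_le_card (Finset.filter_subset _ _)
  have h2 : lam.colLen j ≤ n := by
    rw [YoungDiagram.colLen_eq_card, ← hlam']
    exact Finset.card_le_card (Finset.filter_subset _ _)
  have h3 := YoungDiagram.mem_iff_lt_rowLen.1 hij'
  have h4 := YoungDiagram.mem_iff_lt_colLen.1 hij'
  simp only [Finset.coe_product, Finset.coe_range, Set.mem_prod, Set.mem_Iio]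
  omega

/-- The finite set of partitions (Young diagrams) of `n`. -/
noncomputable def partitions (n : ℕ) : Finset YoungDiagram := (finite_partitions n).toFinset

/-- The tableau `T` has content `μ`. Entries of tableaux are numbered from `0` here, so that the
letter `i` stands for the positive integer `i + 1`, and it has to occur `μ_{i+1}` times. -/
def HasContent {lam : YoungDiagram} (T : SemistandardYoungTableau lam) (mu : YoungDiagram) : Prop :=
  ∀ i : ℕ, (lam.cells.filter fun c => T c.1 c.2 = i).card = mu.rowLen i

theorem finite_tableaux (lam mu : YoungDiagram) :
    {T : SemistandardYoungTableau lam | HasContent T mu}.Finite := by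
  let r : SemistandardYoungTableau lam → (lam.cells → ℕ) := fun T c => T c.1.1 c.1.2
  have hinj : Function.Injective r := by
    intro T T' h
    apply SemistandardYoungTableau.ext
    intro i j
    by_cases hij : (i, j) ∈ lam
    · exact congrFun h ⟨(i, j), hij⟩
    · rw [T.zeros hij, T'.zeros hij]
  refine Set.Finite.of_finite_image (f := r) (Set.Finite.subset
    (Set.Finite.pi' (t := fun _ : lam.cells => Set.Iio (mu.colLen 0))
      fun _ => Set.finite_Iio _) ?_) hinj.injOn
  rintro _ ⟨T, hT, rfl⟩ c
  have hpos : 0 < mu.rowLen (T c.1.1 c.1.2) := by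
    rw [← hT, Finset.card_pos]
    exact ⟨c.1, Finset.mem_filter.2 ⟨c.2, rfl⟩⟩
  exact YoungDiagram.mem_iff_lt_colLen.1 (YoungDiagram.mem_iff_lt_rowLen.2 hpos)

/-- The semistandard Young tableaux of shape `λ` and content `μ`. -/
noncomputable def tableaux (lam mu : YoungDiagram) : Finset (SemistandardYoungTableau lam) :=
  (finite_tableaux lam mu).toFinset

/-- The row word `w_r(T)`: the entries of `T`, read from left to right, bottom row first. -/
def rowWord {lam : YoungDiagram} (T : SemistandardYoungTableau lam) : List ℕ :=
  (List.range (lam.colLen 0)).reverse.flatMap fun i =>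
    (List.range (lam.rowLen i)).map fun j => T i j

/-- The sign `(-1)^ℓ` of a word, where `ℓ` is the length of a minimal length permutation that
sorts the word into non-decreasing order. -/
noncomputable def wordSign (w : List ℕ) : ℤ :=
  (-1) ^ sInf (permLength '' {σ : Equiv.Perm (Fin w.length) | Monotone (w.get ∘ σ)})

/-- `sign(T)`, the sign of the row word of `T`. -/
noncomputable def tableauSign {lam : YoungDiagram} (T : SemistandardYoungTableau lam) : ℤ :=
  wordSign (rowWord T)

/-- The odd Kostka number `K_{λμ} = sign(T_λ) ∑_T sign(T)`, where `T` runs over the semistandard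
Young tableaux of shape `λ` and content `μ`, and `T_λ` is the one of shape and content `λ`. -/
noncomputable def kostka (lam mu : YoungDiagram) : ℤ :=
  tableauSign (SemistandardYoungTableau.highestWeight lam) * ∑ T ∈ tableaux lam mu, tableauSign T

/-! ### Odd Schur functions and odd monomial functions -/

/-- `⟨λ⟩ = ∑ᵢ λᵢ (λᵢ + 1) / 2`. -/
def angle (lam : YoungDiagram) : ℕ := (lam.rowLens.map fun a => a * (a + 1) / 2).sum

section Families

variable {k : Type*} [CommRing k]

/-- The family `s` consists of the odd Schur functions: `h_μ = ∑_{λ ⊢ n} K_{λμ} s_λ` for every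
`n` and every partition `μ` of `n`. -/
def IsOddSchur (s : YoungDiagram → OddSymFun k) : Prop :=
  ∀ n : ℕ, ∀ mu ∈ partitions n, complete k mu = ∑ lam ∈ partitions n, kostka lam mu • s lam

/-- The family `m` consists of the odd monomial functions: for every `n`, the `m_λ` with `λ ⊢ n`
lie in `Λ_n`, and they are dual there to the `h_λ` with `λ ⊢ n`. -/
def IsOddMonomial (m : YoungDiagram → OddSymFun k) : Prop :=
  ∀ n : ℕ, ∀ mu ∈ partitions n, m mu ∈ homogeneous k n ∧
    ∀ lam ∈ partitions n, form k (complete k lam) (m mu) = if lam = mu then 1 else 0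

end Families

end OddSym

namespace OddSym
open Finset

/-! ### Young diagrams and their rows -/

/-! Write w(λ) for `rowWeight λ`, the sum of i·λ_i with rows numbered from 0. Since ⟨λ^T⟩ = w(λ) +
|λ|, the sign in the theorem is (-1)^w(λ) (`neg_one_pow_angle`). Everything rests on a signed Cauchy
identity, `pairing_eq_sum`: for all compositions α, β, (h_β, h_α) = ∑_λ (-1)^w(λ) K_{λβ} K_{λα}.

On the left, double cosets correspond to nonnegative integer matrices with row sums α and column
sums β, and the minimal length in a coset is the number of inversions of its matrix
(`cosetLength_mk`). So the form is a signed count of matrices, computed by removing the last row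
(`pairing_eq_matrixSum`).

On the right, removing the largest letter of a tableau removes a horizontal strip, so signed tableau
sums arise from the empty diagram by operators U_b (`addStrip`). Let D_a (`removeStrip`) be the
adjoint of U_a for the form with (λ, λ) = (-1)^w(λ). The local rule of the RSK correspondence, with
signs, gives D_a U_b = ∑_i (-1)^((a-i)(b-i)) U_{b-i} D_{a-i} (`removeStrip_addStrip`); its signs
agree because a parity sum telescopes over the rows (`exchange_parity`). Moving D_a through a
product of operators U down to the empty diagram reproduces the row recursion for matrices
(`removeStrip_signedCount`, `cauchy_identity`).

The rest is linear algebra. The matrices K are unitriangular over ℤ; let J be their inverse. Then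
s_λ = ∑_μ J_{μλ} h_μ, and the Cauchy identity yields (h_β, s_λ) = (-1)^w(λ) K_{λβ}, whence signed
orthonormality. The form on Λ is nondegenerate, so h_α is a combination of the s_λ for every
composition α, not only for partitions. Thus pairings with the h_λ determine an element of Λ_n,
which gives uniqueness of the m_μ; inverting K once more gives their relation to the s_λ. -/

theorem sum_cells {M : Type*} [AddCommMonoid M] (lam : YoungDiagram) {N : ℕ}
    (hN : lam.colLen 0 ≤ N) (F : ℕ → ℕ → M) :
    ∑ c ∈ lam.cells, F c.1 c.2 = ∑ i ∈ range N, ∑ j ∈ range (lam.rowLen i), F i j := by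
  rw [Finset.sum_sigma']
  refine Finset.sum_nbij' (fun c => ⟨c.1, c.2⟩) (fun c => (c.1, c.2)) ?_ ?_ ?_ ?_ ?_
  · rintro ⟨i, j⟩ h
    have h' : (i, j) ∈ lam := h
    have h0 : (i, 0) ∈ lam := lam.up_left_mem le_rfl (Nat.zero_le j) h'
    simp only [mem_sigma, mem_range]
    exact ⟨(YoungDiagram.mem_iff_lt_colLen.1 h0).trans_le hN, YoungDiagram.mem_iff_lt_rowLen.1 h'⟩
  · rintro ⟨i, j⟩ h
    simp only [mem_sigma, mem_range] at h
    exact YoungDiagram.mem_iff_lt_rowLen.2 h.2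
  all_goals simp

theorem rowLen_eq_zero (lam : YoungDiagram) {i : ℕ} (h : lam.colLen 0 ≤ i) :
    lam.rowLen i = 0 := by
  by_contra h0
  have := YoungDiagram.mem_iff_lt_colLen.1
    (YoungDiagram.mem_iff_lt_rowLen.2 (Nat.pos_of_ne_zero h0))
  omega

theorem colLen_le_of_rowLen_eq_zero (lam : YoungDiagram) {i : ℕ} (h : lam.rowLen i = 0) :
    lam.colLen 0 ≤ i := by
  by_contra h0
  have := YoungDiagram.mem_iff_lt_rowLen.1
    (YoungDiagram.mem_iff_lt_colLen.2 (not_le.1 h0))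
  omega

theorem card_eq_sum (lam : YoungDiagram) {N : ℕ} (hN : lam.colLen 0 ≤ N) :
    lam.card = ∑ i ∈ range N, lam.rowLen i := by
  have := sum_cells lam hN (fun _ _ => 1)
  simpa using this

theorem diagram_ext {lam mu : YoungDiagram} (h : ∀ i, lam.rowLen i = mu.rowLen i) :
    lam = mu := by
  refine YoungDiagram.ext (Finset.ext fun c => ?_)
  change (c.1, c.2) ∈ lam ↔ (c.1, c.2) ∈ mu
  rw [YoungDiagram.mem_iff_lt_rowLen, YoungDiagram.mem_iff_lt_rowLen, h]

theorem rowLen_bot (i : ℕ) : (⊥ : YoungDiagram).rowLen i = 0 := by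
  by_contra h0
  exact YoungDiagram.notMem_bot _ (YoungDiagram.mem_iff_lt_rowLen.2 (Nat.pos_of_ne_zero h0))

theorem card_eq_zero_iff (lam : YoungDiagram) : lam.card = 0 ↔ lam = ⊥ := by
  constructor
  · intro h
    exact YoungDiagram.ext (Finset.card_eq_zero.1 h)
  · rintro rfl
    rfl

theorem mem_partitions {n : ℕ} {lam : YoungDiagram} : lam ∈ partitions n ↔ lam.card = n := by
  simp [partitions]

/-- The Young diagram with row lengths `f 0, …, f (N - 1)`, if these are antitone. -/
def ofRows (f : ℕ → ℕ) (N : ℕ) : YoungDiagram where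
  -- The bound is imposed for all rows up to the given one, so that this is a lower set for every
  -- `f`.
  cells := (range N ×ˢ range (f 0)).filter fun c => ∀ i ≤ c.1, c.2 < f i
  isLowerSet := by
    rintro ⟨i, j⟩ ⟨i', j'⟩ h hc
    obtain ⟨h1, h2⟩ := Prod.mk_le_mk.1 h
    simp only [coe_filter, mem_product, mem_range, Set.mem_ofPred_eq] at hc ⊢
    exact ⟨⟨by omega, by omega⟩, fun l hl => lt_of_le_of_lt h2 (hc.2 l (hl.trans h1))⟩

theorem rowLen_ofRows {f : ℕ → ℕ} {N : ℕ} (hf : ∀ i, f (i + 1) ≤ f i) (hN : ∀ i, N ≤ i → f i = 0)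
    (i : ℕ) : (ofRows f N).rowLen i = f i := by
  have hanti : Antitone f := antitone_nat_of_succ_le hf
  have key : ∀ j, j < (ofRows f N).rowLen i ↔ j < f i := by
    intro j
    rw [← YoungDiagram.mem_iff_lt_rowLen, ← YoungDiagram.mem_cells]
    simp only [ofRows, mem_filter, mem_product, mem_range]
    constructor
    · exact fun h => h.2 i le_rfl
    · intro h
      refine ⟨⟨?_, h.trans_le (hanti (Nat.zero_le i))⟩, fun l hl => h.trans_le (hanti hl)⟩
      by_contra h0
      rw [hN i (not_lt.1 h0)] at h
      omega
  have h1 := key (f i)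
  have h2 := key ((ofRows f N).rowLen i)
  omega

/-! ### Horizontal strips -/

/-- `λ / κ` is a horizontal strip. -/
def HStrip (kap lam : YoungDiagram) : Prop :=
  ∀ i, lam.rowLen (i + 1) ≤ kap.rowLen i ∧ kap.rowLen i ≤ lam.rowLen i

theorem HStrip.card_le {kap lam : YoungDiagram} (h : HStrip kap lam) : kap.card ≤ lam.card := by
  have hle : kap.colLen 0 ≤ lam.colLen 0 :=
    colLen_le_of_rowLen_eq_zero _
      (Nat.le_zero.1 ((h _).2.trans_eq (rowLen_eq_zero lam le_rfl)))
  rw [card_eq_sum kap hle, card_eq_sum lam le_rfl]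
  exact Finset.sum_le_sum fun i _ => (h i).2

theorem finite_below (lam : YoungDiagram) (a : ℕ) :
    {kap : YoungDiagram | HStrip kap lam ∧ kap.card + a = lam.card}.Finite := by
  refine (finite_partitions (lam.card - a)).subset ?_
  rintro kap ⟨-, h⟩
  simp only [Set.mem_ofPred_eq]
  omega

theorem finite_above (lam : YoungDiagram) (a : ℕ) :
    {nu : YoungDiagram | HStrip lam nu ∧ lam.card + a = nu.card}.Finite := by
  refine (finite_partitions (lam.card + a)).subset ?_
  rintro kap ⟨-, h⟩
  exact h.symm

/-- The diagrams `κ` for which `λ / κ` is a horizontal strip with `a` cells. -/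
noncomputable def below (lam : YoungDiagram) (a : ℕ) : Finset YoungDiagram :=
  (finite_below lam a).toFinset

/-- The diagrams `ν` for which `ν / λ` is a horizontal strip with `a` cells. -/
noncomputable def above (lam : YoungDiagram) (a : ℕ) : Finset YoungDiagram :=
  (finite_above lam a).toFinset

theorem mem_below {lam kap : YoungDiagram} {a : ℕ} :
    kap ∈ below lam a ↔ HStrip kap lam ∧ kap.card + a = lam.card := by
  simp [below]

theorem mem_above {lam nu : YoungDiagram} {a : ℕ} :
    nu ∈ above lam a ↔ HStrip lam nu ∧ lam.card + a = nu.card := by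
  simp [above]

/-- The number of inversions that are added to the row word of a tableau of shape `κ` when the
strip `λ / κ` is filled with a new largest letter. -/
def stripInv (kap lam : YoungDiagram) : ℕ :=
  ∑ i ∈ range (lam.colLen 0), (lam.rowLen i - kap.rowLen i) * ∑ l ∈ range i, kap.rowLen l

theorem stripInv_eq (kap lam : YoungDiagram) {N : ℕ} (hN : lam.colLen 0 ≤ N) :
    stripInv kap lam
      = ∑ i ∈ range N, (lam.rowLen i - kap.rowLen i) * ∑ l ∈ range i, kap.rowLen l := by
  refine Finset.sum_subset (Finset.range_mono hN) fun i _ hi => ?_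
  rw [rowLen_eq_zero lam (by simpa using hi)]
  simp

/-- The sum of the (zero-based) row numbers of the cells. -/
def rowWeight (lam : YoungDiagram) : ℕ := ∑ c ∈ lam.cells, c.1

theorem rowWeight_eq (lam : YoungDiagram) {N : ℕ} (hN : lam.colLen 0 ≤ N) :
    rowWeight lam = ∑ i ∈ range N, i * lam.rowLen i := by
  rw [rowWeight, sum_cells lam hN (fun i _ => i)]
  simp [mul_comm]

/-! ### The exchange of an upward strip and a downward strip -/

/-- The right side is the boundary term that makes the sum telescope, so induction on `N` works. In
the application m = min(λ, μ), p and q are the positive parts of μ - λ and λ - μ (hence p·q = 0),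
and c_i = ν_i - max(λ_i, μ_i), which also equals min(λ_{i-1}, μ_{i-1}) - κ_{i-1} for i > 0. Past the
last row c vanishes, and the boundary term with it. -/
theorem exchange_parity_aux (m p q c : ℕ → ZMod 2) (hpq : ∀ i, p i * q i = 0) (N : ℕ) :
    (∑ i ∈ range N,
      ((i : ZMod 2) * (p i + c i + (p i + c (i + 1)))
        + (p i + c i) * ∑ l ∈ range i, (m l + q l) + (q i + c i) * ∑ l ∈ range i, (m l + p l)
        + (p i + c (i + 1)) * ∑ l ∈ range i, (m l + c (l + 1))
        + (q i + c (i + 1)) * ∑ l ∈ range i, (m l + c (l + 1))))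
      + (∑ i ∈ range N, (q i + c (i + 1))) * (∑ i ∈ range N, (p i + c (i + 1)))
    = c N * (N + ∑ i ∈ range N, p i + ∑ i ∈ range N, q i) := by
  have hsq : ∀ a : ZMod 2, a * a = a := by decide
  have h2 : ∀ a : ZMod 2, a + a = 0 := by decide
  induction N with
  | zero => simp
  | succ N ih =>
    simp only [sum_range_succ, Finset.sum_add_distrib, Nat.cast_add, Nat.cast_one] at ih ⊢
    have e1 := hpq N
    have e2 := hsq (c (N + 1))
    generalize (∑ i ∈ range N, p i) = P at *
    generalize (∑ i ∈ range N, q i) = Q at *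
    generalize (∑ i ∈ range N, m i) = M at *
    generalize (∑ i ∈ range N, c (i + 1)) = C at *
    generalize p N = p' at *
    generalize q N = q' at *
    generalize c (N + 1) = c1 at *
    generalize c N = c0 at *
    generalize (N : ZMod 2) = n at *
    grind

theorem neg_one_pow_of_cast_eq {a b : ℕ} (h : (a : ZMod 2) = b) : (-1 : ℤ) ^ a = (-1) ^ b := by
  rw [neg_one_pow_eq_pow_mod_two, (ZMod.natCast_eq_natCast_iff' a b 2).1 h,
    ← neg_one_pow_eq_pow_mod_two]

theorem HStrip.colLen_le {kap lam : YoungDiagram} (h : HStrip kap lam) :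
    kap.colLen 0 ≤ lam.colLen 0 :=
  colLen_le_of_rowLen_eq_zero _ (Nat.le_zero.1 ((h _).2.trans_eq (rowLen_eq_zero lam le_rfl)))

/-- `ν` and `κ` correspond to each other under the local rule at `λ` and `μ`. -/
def Exchange (lam mu nu kap : YoungDiagram) : Prop :=
  ∀ i, nu.rowLen (i + 1) + kap.rowLen i
    = max (lam.rowLen (i + 1)) (mu.rowLen (i + 1)) + min (lam.rowLen i) (mu.rowLen i)

/-- This compares the sign of the path λ, ν, μ (strip added, then strip removed) with that of λ, κ,
μ. Modulo 2 all row lengths and strip lengths are sums of m, p, q, c, which reduces the claim to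
`exchange_parity_aux`. -/
theorem exchange_parity {lam mu nu kap : YoungDiagram} {a b : ℕ}
    (h1 : HStrip lam nu) (h2 : HStrip mu nu) (h3 : HStrip kap lam) (h4 : HStrip kap mu)
    (hx : Exchange lam mu nu kap) (hb : kap.card + b = lam.card) (ha : kap.card + a = mu.card) :
    (-1 : ℤ) ^ (rowWeight lam + rowWeight nu + stripInv lam nu + stripInv mu nu)
      = (-1) ^ (a * b + (stripInv kap lam + (rowWeight kap + rowWeight mu + stripInv kap mu))) := by
  apply neg_one_pow_of_cast_eq
  -- All diagrams are empty from row `N - 1` on; the extra 1 makes `c N` fall into the successor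
  -- case below, where it is visibly 0.
  set N := nu.colLen 0 + 1 with hN
  have n1 := h1.colLen_le
  have n2 := h2.colLen_le
  have n3 := h3.colLen_le
  let m : ℕ → ZMod 2 := fun i => (min (lam.rowLen i) (mu.rowLen i) : ℕ)
  let p : ℕ → ZMod 2 := fun i => (mu.rowLen i - lam.rowLen i : ℕ)
  let q : ℕ → ZMod 2 := fun i => (lam.rowLen i - mu.rowLen i : ℕ)
  let c : ℕ → ZMod 2 := fun i => match i with
    | 0 => (nu.rowLen 0 - max (lam.rowLen 0) (mu.rowLen 0) : ℕ)
    | i + 1 => (min (lam.rowLen i) (mu.rowLen i) - kap.rowLen i : ℕ)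
  have hpq : ∀ i, p i * q i = 0 := by
    intro i
    simp only [p, q, ← Nat.cast_mul]
    rcases le_total (mu.rowLen i) (lam.rowLen i) with h | h
    · rw [Nat.sub_eq_zero_of_le h]; simp
    · rw [Nat.sub_eq_zero_of_le h]; simp
  have hcN : c N = 0 := by
    simp only [c, hN, rowLen_eq_zero lam n1]
    simp
  have key := exchange_parity_aux m p q c hpq N
  rw [hcN, zero_mul] at key
  have ex : ∀ i, (lam.rowLen i : ZMod 2) = m i + q i := fun i => by
    simp only [m, q, ← Nat.cast_add]; congr 1; omega
  have ey : ∀ i, (mu.rowLen i : ZMod 2) = m i + p i := fun i => by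
    simp only [m, p, ← Nat.cast_add]; congr 1; omega
  have eyk : ∀ i, ((mu.rowLen i - kap.rowLen i : ℕ) : ZMod 2) = p i + c (i + 1) := fun i => by
    have := (h3 i).2
    have := (h4 i).2
    simp only [c, p, ← Nat.cast_add]; congr 1; omega
  have exk : ∀ i, ((lam.rowLen i - kap.rowLen i : ℕ) : ZMod 2) = q i + c (i + 1) := fun i => by
    have := (h3 i).2
    have := (h4 i).2
    simp only [c, q, ← Nat.cast_add]; congr 1; omega
  have enx : ∀ i, ((nu.rowLen i - lam.rowLen i : ℕ) : ZMod 2) = p i + c i := fun i => by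
    have := (h1 i).2
    have := (h2 i).2
    rcases i with _ | i
    · simp only [c, p, ← Nat.cast_add]; congr 1; omega
    · have := hx i
      have := (h3 i).2
      have := (h4 i).2
      simp only [c, p, ← Nat.cast_add]; congr 1; omega
  have eny : ∀ i, ((nu.rowLen i - mu.rowLen i : ℕ) : ZMod 2) = q i + c i := fun i => by
    have := (h1 i).2
    have := (h2 i).2
    rcases i with _ | i
    · simp only [c, q, ← Nat.cast_add]; congr 1; omega
    · have := hx i
      have := (h3 i).2
      have := (h4 i).2
      simp only [c, q, ← Nat.cast_add]; congr 1; omega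
  have hdbl : ∀ a : ZMod 2, a + a = 0 := by decide
  have ek : ∀ i, (kap.rowLen i : ZMod 2) = m i + c (i + 1) := fun i => by
    have := exk i
    rw [Nat.cast_sub (h3 i).2, ex] at this
    have h := hdbl (c (i + 1))
    linear_combination (-1 : ZMod 2) * this - h
  have en : ∀ i, (nu.rowLen i : ZMod 2) = m i + q i + (p i + c i) := fun i => by
    have := enx i
    rw [Nat.cast_sub (h1 i).2, ex] at this
    linear_combination this
  have eb : (b : ZMod 2) = ∑ i ∈ range N, (q i + c (i + 1)) := by
    have h := congrArg (Nat.cast : ℕ → ZMod 2) hb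
    rw [card_eq_sum lam (show _ ≤ N by omega), card_eq_sum kap (show _ ≤ N by omega)] at h
    simp only [Nat.cast_add, Nat.cast_sum, ← exk, Nat.cast_sub (h3 _).2, sum_sub_distrib] at h ⊢
    linear_combination h
  have ea : (a : ZMod 2) = ∑ i ∈ range N, (p i + c (i + 1)) := by
    have h := congrArg (Nat.cast : ℕ → ZMod 2) ha
    rw [card_eq_sum mu (show _ ≤ N by omega), card_eq_sum kap (show _ ≤ N by omega)] at h
    simp only [Nat.cast_add, Nat.cast_sum, ← eyk, Nat.cast_sub (h4 _).2, sum_sub_distrib] at h ⊢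
    linear_combination h
  rw [rowWeight_eq lam (show _ ≤ N by omega), rowWeight_eq mu (show _ ≤ N by omega),
    rowWeight_eq nu (show _ ≤ N by omega), rowWeight_eq kap (show _ ≤ N by omega),
    stripInv_eq lam nu (show _ ≤ N by omega), stripInv_eq mu nu (show _ ≤ N by omega),
    stripInv_eq kap lam (show _ ≤ N by omega), stripInv_eq kap mu (show _ ≤ N by omega)]
  push_cast only [Nat.cast_add, Nat.cast_mul, Nat.cast_sum]
  rw [ea, eb]
  simp only [ek, en, ex, ey, enx, eny, exk, eyk]
  rw [mul_comm] at key
  rw [← sub_eq_zero, CharTwo.sub_eq_add]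
  have hw : ∀ i ∈ range N, (i : ZMod 2) * (m i + q i) + i * (m i + q i + (p i + c i))
      + (i * (m i + c (i + 1)) + i * (m i + p i))
      = i * (p i + c i + (p i + c (i + 1))) := fun i _ => by
    have h1 := hdbl (i * m i)
    have h2 := hdbl (i * q i)
    linear_combination 2 * h1 + h2
  have hw' := Finset.sum_congr rfl hw
  simp only [Finset.sum_add_distrib] at hw' key ⊢
  linear_combination key + hw'

/-- Summing the local rule over the rows leaves out row 0 of ν and the maximum in row 0. Their
difference is the number of cells by which both strips shrink when ν is replaced by κ. -/
theorem Exchange.card {lam mu nu kap : YoungDiagram}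
    (h1 : HStrip lam nu) (h2 : HStrip mu nu) (h3 : HStrip kap lam)
    (hx : Exchange lam mu nu kap) :
    nu.card + kap.card + max (lam.rowLen 0) (mu.rowLen 0)
      = lam.card + mu.card + nu.rowLen 0 := by
  have n1 := h1.colLen_le
  have n2 := h2.colLen_le
  have n3 := h3.colLen_le
  have hs := Finset.sum_congr (rfl : range (nu.colLen 0) = _) fun i _ => hx i
  have hm : ∑ i ∈ range (nu.colLen 0), max (lam.rowLen i) (mu.rowLen i)
      + ∑ i ∈ range (nu.colLen 0), min (lam.rowLen i) (mu.rowLen i)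
      = ∑ i ∈ range (nu.colLen 0), lam.rowLen i + ∑ i ∈ range (nu.colLen 0), mu.rowLen i := by
    rw [← sum_add_distrib, ← sum_add_distrib]
    exact Finset.sum_congr rfl fun i _ => max_add_min _ _
  have hs0 := Finset.sum_range_succ (fun i => max (lam.rowLen i) (mu.rowLen i)) (nu.colLen 0)
  rw [Finset.sum_range_succ', rowLen_eq_zero lam n1, rowLen_eq_zero mu n2] at hs0
  rw [sum_add_distrib, sum_add_distrib] at hs
  rw [card_eq_sum nu (Nat.le_succ _), Finset.sum_range_succ', card_eq_sum kap (n3.trans n1),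
    card_eq_sum lam n1, card_eq_sum mu n2]
  simp only [max_self] at hs0
  omega

/-- The diagram `κ` that corresponds to `ν` under the local rule at `λ` and `μ`. -/
def inner (lam mu nu : YoungDiagram) : YoungDiagram :=
  ofRows (fun i => max (lam.rowLen (i + 1)) (mu.rowLen (i + 1))
    + min (lam.rowLen i) (mu.rowLen i) - nu.rowLen (i + 1)) (lam.colLen 0)

/-- The diagram `ν` that corresponds to `κ` and the number `j` under the local rule at `λ`
and `μ`. -/
def outer (lam mu kap : YoungDiagram) (j : ℕ) : YoungDiagram :=
  ofRows (fun i => match i with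
    | 0 => max (lam.rowLen 0) (mu.rowLen 0) + j
    | i + 1 => max (lam.rowLen (i + 1)) (mu.rowLen (i + 1))
      + min (lam.rowLen i) (mu.rowLen i) - kap.rowLen i) (lam.colLen 0 + mu.colLen 0 + 1)

theorem rowLen_inner {lam mu nu : YoungDiagram} (h1 : HStrip lam nu) (h2 : HStrip mu nu) (i : ℕ) :
    (inner lam mu nu).rowLen i = max (lam.rowLen (i + 1)) (mu.rowLen (i + 1))
      + min (lam.rowLen i) (mu.rowLen i) - nu.rowLen (i + 1) := by
  refine rowLen_ofRows ?_ ?_ i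
  · intro i
    have := h1 i
    have := h2 i
    have := h1 (i + 1)
    have := h2 (i + 1)
    have := h1 (i + 1 + 1)
    have := h2 (i + 1 + 1)
    omega
  · intro i hi
    have h3 := rowLen_eq_zero lam hi
    have h4 : lam.rowLen (i + 1) = 0 := rowLen_eq_zero lam (hi.trans (Nat.le_succ i))
    have := h2 (i + 1)
    have := h1 i
    omega

theorem rowLen_outer_zero {lam mu kap : YoungDiagram} (h3 : HStrip kap lam) (h4 : HStrip kap mu)
    (j : ℕ) : (outer lam mu kap j).rowLen 0 = max (lam.rowLen 0) (mu.rowLen 0) + j ∧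
      ∀ i, (outer lam mu kap j).rowLen (i + 1) = max (lam.rowLen (i + 1)) (mu.rowLen (i + 1))
      + min (lam.rowLen i) (mu.rowLen i) - kap.rowLen i := by
  have key := @rowLen_ofRows (fun i => match i with
    | 0 => max (lam.rowLen 0) (mu.rowLen 0) + j
    | i + 1 => max (lam.rowLen (i + 1)) (mu.rowLen (i + 1))
      + min (lam.rowLen i) (mu.rowLen i) - kap.rowLen i) (lam.colLen 0 + mu.colLen 0 + 1) ?_ ?_
  · exact ⟨key 0, fun i => key (i + 1)⟩
  · intro i
    have := h3 i
    have := h4 i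
    rcases i with _ | i
    · simp only; omega
    · have := h3 (i + 1)
      have := h4 (i + 1)
      have := h3 i
      have := h4 i
      simp only; omega
  · intro i hi
    rcases i with _ | i
    · omega
    · have := rowLen_eq_zero lam (show lam.colLen 0 ≤ i by omega)
      have := rowLen_eq_zero lam (show lam.colLen 0 ≤ i + 1 by omega)
      have := rowLen_eq_zero mu (show mu.colLen 0 ≤ i + 1 by omega)
      simp only; omega

theorem inner_spec {lam mu nu : YoungDiagram} (h1 : HStrip lam nu) (h2 : HStrip mu nu) :
    HStrip (inner lam mu nu) lam ∧ HStrip (inner lam mu nu) mu ∧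
      Exchange lam mu nu (inner lam mu nu) := by
  refine ⟨fun i => ?_, fun i => ?_, fun i => ?_⟩ <;>
  · rw [rowLen_inner h1 h2]
    have := h1 i
    have := h2 i
    have := h1 (i + 1)
    have := h2 (i + 1)
    omega

theorem outer_spec {lam mu kap : YoungDiagram} (h3 : HStrip kap lam) (h4 : HStrip kap mu) (j : ℕ) :
    HStrip lam (outer lam mu kap j) ∧ HStrip mu (outer lam mu kap j) ∧
      Exchange lam mu (outer lam mu kap j) kap := by
  obtain ⟨e0, e⟩ := rowLen_outer_zero h3 h4 j
  refine ⟨fun i => ?_, fun i => ?_, fun i => ?_⟩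
  on_goal 3 =>
    rw [e]
    have := h3 i
    have := h4 i
    omega
  all_goals
    have := h3 i
    have := h4 i
    rcases i with _ | i
    · rw [e, e0]
      omega
    · rw [e, e]
      have := h3 i
      have := h4 i
      omega

theorem inner_outer {lam mu kap : YoungDiagram} (h3 : HStrip kap lam) (h4 : HStrip kap mu)
    (j : ℕ) : inner lam mu (outer lam mu kap j) = kap := by
  obtain ⟨h1, h2, hx⟩ := outer_spec h3 h4 j
  refine diagram_ext fun i => ?_
  rw [rowLen_inner h1 h2]
  have := hx i
  omega

theorem outer_inner {lam mu nu : YoungDiagram} (h1 : HStrip lam nu) (h2 : HStrip mu nu) :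
    outer lam mu (inner lam mu nu) (nu.rowLen 0 - max (lam.rowLen 0) (mu.rowLen 0)) = nu := by
  obtain ⟨h3, h4, hx⟩ := inner_spec h1 h2
  obtain ⟨e0, e⟩ :=
    rowLen_outer_zero h3 h4 (nu.rowLen 0 - max (lam.rowLen 0) (mu.rowLen 0))
  refine diagram_ext fun i => ?_
  rcases i with _ | i
  · rw [e0]
    have := h1 0
    have := h2 0
    omega
  · rw [e]
    have := hx i
    omega

/-- Signed addition of horizontal strips with `b` cells, as an operator on functions of
diagrams. -/
noncomputable def addStrip (b : ℕ) (f : YoungDiagram → ℤ) (nu : YoungDiagram) : ℤ :=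
  ∑ mu ∈ below nu b, (-1) ^ stripInv mu nu * f mu

/-- Signed removal of horizontal strips with `a` cells, the adjoint of `addStrip a` for the form
with `(λ, λ) = (-1) ^ rowWeight λ`. -/
noncomputable def removeStrip (a : ℕ) (f : YoungDiagram → ℤ) (lam : YoungDiagram) : ℤ :=
  ∑ nu ∈ above lam a, (-1) ^ (rowWeight lam + rowWeight nu + stripInv lam nu) * f nu

/-- For fixed λ and μ, the local rule is a bijection from diagrams ν to pairs (i, κ), where i = ν_0
- max(λ_0, μ_0) is the excess of the first row. It shortens both strips by i, and `exchange_parity`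
accounts for the signs. In terms of RSK, i is the matrix entry in the corresponding square of a
growth diagram. -/
theorem removeStrip_addStrip (a b : ℕ) (f : YoungDiagram → ℤ) (lam : YoungDiagram) :
    removeStrip a (addStrip b f) lam
      = ∑ i ∈ range (min a b + 1), (-1) ^ ((a - i) * (b - i))
          * addStrip (b - i) (removeStrip (a - i) f) lam := by
  simp only [removeStrip, addStrip, mul_sum]
  rw [Finset.sum_sigma', Finset.sum_sigma']
  simp only [Finset.sum_sigma']
  refine Finset.sum_nbij'
    (fun x => ⟨⟨x.1.rowLen 0 - max (lam.rowLen 0) (x.2.rowLen 0), inner lam x.2 x.1⟩, x.2⟩)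
    (fun x => ⟨outer lam x.2 x.1.2 x.1.1, x.2⟩) ?_ ?_ ?_ ?_ ?_
  · rintro ⟨nu, mu⟩ h
    simp only [mem_sigma, mem_above, mem_below, mem_range] at h ⊢
    obtain ⟨⟨h1, ha⟩, h2, hb⟩ := h
    obtain ⟨h3, h4, hx⟩ := inner_spec h1 h2
    have := hx.card h1 h2 h3
    have := h3.card_le
    have := h4.card_le
    have := h1 0
    have := h2 0
    exact ⟨⟨by omega, h3, by omega⟩, h4, by omega⟩
  · rintro ⟨⟨i, kap⟩, mu⟩ h
    simp only [mem_sigma, mem_above, mem_below, mem_range] at h ⊢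
    obtain ⟨⟨hi, h3, hb⟩, h4, ha⟩ := h
    obtain ⟨h1, h2, hx⟩ := outer_spec h3 h4 i
    have := hx.card h1 h2 h3
    have := (rowLen_outer_zero h3 h4 i).1
    exact ⟨⟨h1, by omega⟩, h2, by omega⟩
  · rintro ⟨nu, mu⟩ h
    simp only [mem_sigma, mem_above, mem_below] at h
    simp only [outer_inner h.1.1 h.2.1]
  · rintro ⟨⟨i, kap⟩, mu⟩ h
    simp only [mem_sigma, mem_above, mem_below, mem_range] at h
    obtain ⟨⟨-, h3, -⟩, h4, -⟩ := h
    simp only [inner_outer h3 h4, (rowLen_outer_zero h3 h4 i).1, Nat.add_sub_cancel_left]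
  · rintro ⟨nu, mu⟩ h
    simp only [mem_sigma, mem_above, mem_below] at h
    obtain ⟨⟨h1, ha⟩, h2, hb⟩ := h
    obtain ⟨h3, h4, hx⟩ := inner_spec h1 h2
    have := hx.card h1 h2 h3
    have := h3.card_le
    have := h4.card_le
    have := h1 0
    have := h2 0
    have hs := exchange_parity h1 h2 h3 h4 hx
      (a := a - (nu.rowLen 0 - max (lam.rowLen 0) (mu.rowLen 0)))
      (b := b - (nu.rowLen 0 - max (lam.rowLen 0) (mu.rowLen 0))) (by omega) (by omega)
    simp only [← mul_assoc, ← pow_add]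
    rw [hs]

/-! ### Signed tableau sums and their Cauchy identity -/

/-- The sum of the signs of the semistandard tableaux with `c i` entries `i`, for `i < r`, defined
by successive removal of the largest letter. -/
noncomputable def signedCount (c : ℕ → ℕ) : ℕ → YoungDiagram → ℤ
  | 0 => fun lam => if lam = ⊥ then 1 else 0
  | r + 1 => addStrip (c r) (signedCount c r)

theorem signedCount_zero (c : ℕ → ℕ) (lam : YoungDiagram) :
    signedCount c 0 lam = if lam = ⊥ then 1 else 0 := rfl

theorem signedCount_congr {c d : ℕ → ℕ} {r : ℕ} (h : ∀ i < r, c i = d i) :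
    signedCount c r = signedCount d r := by
  induction r with
  | zero => rfl
  | succ r ih =>
    rw [signedCount, signedCount, ih fun i hi => h i (by omega), h r (by omega)]

theorem signedCount_eq_zero {c : ℕ → ℕ} {r : ℕ} {lam : YoungDiagram}
    (h : lam.card ≠ ∑ i ∈ range r, c i) : signedCount c r lam = 0 := by
  induction r generalizing lam with
  | zero =>
    rw [signedCount_zero, if_neg]
    rintro rfl
    exact h rfl
  | succ r ih =>
    rw [signedCount, addStrip]
    refine Finset.sum_eq_zero fun kap hk => ?_
    rw [sum_range_succ] at h
    rw [ih, mul_zero]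
    have := (mem_below.1 hk).2
    omega

theorem addStrip_sum {ι : Type*} (b : ℕ) (s : Finset ι) (e : ι → ℤ) (g : ι → YoungDiagram → ℤ)
    (lam : YoungDiagram) :
    addStrip b (fun kap => ∑ j ∈ s, e j * g j kap) lam = ∑ j ∈ s, e j * addStrip b (g j) lam := by
  simp only [addStrip, mul_sum]
  rw [Finset.sum_comm]
  exact Finset.sum_congr rfl fun _ _ => Finset.sum_congr rfl fun _ _ => by ring

/-- The vectors `j ≤ β` with support in `{0, …, s - 1}` and sum `a`. -/
noncomputable def subvectors (s a : ℕ) (bet : ℕ → ℕ) : Finset (ℕ → ℕ) :=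
  @Finset.filter _ (· ≤ bet) (Classical.decPred _) (piAntidiag (range s) a)

theorem mem_subvectors {s a : ℕ} {bet j : ℕ → ℕ} :
    j ∈ subvectors s a bet ↔ ∑ i ∈ range s, j i = a ∧ (∀ i, s ≤ i → j i = 0) ∧ j ≤ bet := by
  rw [subvectors, @mem_filter _ _ (Classical.decPred _), mem_piAntidiag, and_assoc]
  refine and_congr_right fun _ => and_congr_left fun _ => forall_congr' fun i => ?_
  rw [mem_range, ← not_lt]
  tauto

/-- The number of inversions between the letters in `j` and the letters that remain. -/
def crossInv (s : ℕ) (bet j : ℕ → ℕ) : ℕ :=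
  ∑ m ∈ range s, (∑ l ∈ range m, j l) * (bet m - j m)

theorem sum_range_update (j : ℕ → ℕ) (s i n : ℕ) (h : n ≤ s) :
    ∑ l ∈ range n, Function.update j s i l = ∑ l ∈ range n, j l :=
  Finset.sum_congr rfl fun l hl => Function.update_of_ne (by have := mem_range.1 hl; omega) _ _

theorem sum_subvectors_succ {M : Type*} [AddCommMonoid M] (s a : ℕ) (bet : ℕ → ℕ)
    (F : (ℕ → ℕ) → M) :
    ∑ j ∈ subvectors (s + 1) a bet, F j
      = ∑ i ∈ range (min a (bet s) + 1), ∑ j ∈ subvectors s (a - i) bet,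
          F (Function.update j s i) := by
  rw [Finset.sum_sigma']
  refine Finset.sum_nbij' (fun j => ⟨j s, Function.update j s 0⟩)
    (fun x => Function.update x.2 s x.1) ?_ ?_ ?_ ?_ ?_
  · intro j h
    simp only [mem_subvectors, mem_sigma, mem_range] at h ⊢
    obtain ⟨h1, h2, h3⟩ := h
    rw [sum_range_succ] at h1
    have : j s ≤ bet s := h3 s
    refine ⟨by omega, ?_, ?_, ?_⟩
    · rw [sum_range_update _ _ _ _ le_rfl]
      omega
    · intro i hi
      rcases eq_or_ne i s with rfl | hne
      · simp
      · rw [Function.update_of_ne hne]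
        exact h2 i (by omega)
    · exact update_le_iff.2 ⟨Nat.zero_le _, fun i _ => h3 i⟩
  · rintro ⟨i, j⟩ h
    simp only [mem_subvectors, mem_sigma, mem_range] at h ⊢
    obtain ⟨hi, h1, h2, h3⟩ := h
    refine ⟨?_, ?_, ?_⟩
    · rw [sum_range_succ, sum_range_update _ _ _ _ le_rfl, Function.update_self]
      omega
    · intro l hl
      rw [Function.update_of_ne (by omega)]
      exact h2 l (by omega)
    · exact update_le_iff.2 ⟨by omega, fun i _ => h3 i⟩
  · intro j _
    simp
  · rintro ⟨i, j⟩ h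
    simp only [mem_subvectors, mem_sigma, mem_range] at h
    have : j s = 0 := h.2.2.1 s le_rfl
    simp [← this]
  · intro j _
    simp

/-- D_a is commuted past one operator U after another, starting with the largest letter; j_m records
how many cells are lost at letter m. The surviving D acts on the indicator of the empty diagram,
which it annihilates unless no cells remain to be removed, so that j has sum a. -/
theorem removeStrip_signedCount (bet : ℕ → ℕ) (s a : ℕ) (lam : YoungDiagram) :
    removeStrip a (signedCount bet s) lam
      = ∑ j ∈ subvectors s a bet, (-1) ^ crossInv s bet j * signedCount (bet - j) s lam := by
  induction s generalizing a lam with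
  | zero =>
    have hR : ∑ j ∈ subvectors 0 a bet, (-1) ^ crossInv 0 bet j * signedCount (bet - j) 0 lam
        = if a = 0 ∧ lam = ⊥ then 1 else 0 := by
      by_cases ha : a = 0
      · subst ha
        have : subvectors 0 0 bet = {0} := by
          ext j
          rw [mem_subvectors, mem_singleton]
          constructor
          · rintro ⟨-, h, -⟩
            exact funext fun i => h i (Nat.zero_le i)
          · rintro rfl
            exact ⟨rfl, fun _ _ => rfl, fun _ => Nat.zero_le _⟩
        rw [this, sum_singleton]
        simp [crossInv, signedCount]
      · have : subvectors 0 a bet = ∅ := by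
          ext j
          rw [mem_subvectors]
          simp [Ne.symm ha]
        rw [this]
        simp [ha]
    rw [hR, removeStrip]
    by_cases h : a = 0 ∧ lam = ⊥
    · obtain ⟨rfl, rfl⟩ := h
      have hm : above (⊥ : YoungDiagram) 0 = {⊥} := by
        ext nu
        rw [mem_above, mem_singleton]
        constructor
        · rintro ⟨-, h⟩
          exact (card_eq_zero_iff nu).1 h.symm
        · rintro rfl
          exact ⟨fun i => by simp only [rowLen_bot]; omega, rfl⟩
      rw [hm, sum_singleton]
      simp [signedCount, rowWeight, stripInv, rowLen_bot]
    · rw [if_neg h]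
      refine Finset.sum_eq_zero fun nu hn => ?_
      rw [signedCount_zero, if_neg, mul_zero]
      rintro rfl
      have h0 : lam.card + a = 0 := (mem_above.1 hn).2
      exact h ⟨by omega, (card_eq_zero_iff lam).1 (by omega)⟩
  | succ s ih =>
    rw [signedCount, removeStrip_addStrip, sum_subvectors_succ]
    refine Finset.sum_congr rfl fun i hi => ?_
    have hi' := mem_range.1 hi
    rw [show removeStrip (a - i) (signedCount bet s) = fun kap =>
      ∑ j ∈ subvectors s (a - i) bet, (-1) ^ crossInv s bet j * signedCount (bet - j) s kap from
      funext fun kap => ih (a - i) kap, addStrip_sum, mul_sum]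
    refine Finset.sum_congr rfl fun j hj => ?_
    obtain ⟨h1, h2, h3⟩ := mem_subvectors.1 hj
    -- The last letter adds as cross inversions exactly the exponent (a - i)(β_s - i) of the
    -- commutation relation.
    have hc : crossInv (s + 1) bet (Function.update j s i)
        = (a - i) * (bet s - i) + crossInv s bet j := by
      rw [crossInv, sum_range_succ, sum_range_update _ _ _ _ le_rfl, h1, Function.update_self,
        add_comm]
      congr 1
      refine Finset.sum_congr rfl fun m hm => ?_
      have := mem_range.1 hm
      rw [sum_range_update _ _ _ _ this.le, Function.update_of_ne (by omega)]
    have hs : signedCount (bet - Function.update j s i) s = signedCount (bet - j) s :=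
      signedCount_congr fun l hl => by
        rw [Pi.sub_apply, Pi.sub_apply, Function.update_of_ne (by omega)]
    rw [hc, pow_add, mul_assoc, signedCount, hs, Pi.sub_apply, Function.update_self]

/-- The signed count of matrices with row sums `α` and column sums `β`, defined by successive
removal of the last row. -/
noncomputable def matrixSum (s : ℕ) (alp : ℕ → ℕ) : ℕ → (ℕ → ℕ) → ℤ
  | 0 => fun bet => if ∀ l < s, bet l = 0 then 1 else 0
  | r + 1 => fun bet =>
    ∑ j ∈ subvectors s (alp r) bet, (-1) ^ crossInv s bet j * matrixSum s alp r (bet - j)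

theorem signedCount_bot (bet : ℕ → ℕ) (s : ℕ) :
    signedCount bet s ⊥ = if ∀ l < s, bet l = 0 then 1 else 0 := by
  induction s with
  | zero => simp [signedCount]
  | succ s ih =>
    rw [signedCount, addStrip]
    by_cases hb : bet s = 0
    · have hm : below (⊥ : YoungDiagram) (bet s) = {⊥} := by
        ext nu
        rw [mem_below, mem_singleton, hb]
        constructor
        · rintro ⟨-, h⟩
          exact (card_eq_zero_iff nu).1 h
        · rintro rfl
          exact ⟨fun i => by simp only [rowLen_bot]; omega, rfl⟩
      rw [hm, sum_singleton, ih]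
      simp only [stripInv, rowLen_bot]
      simp only [tsub_self, zero_mul, sum_const_zero, pow_zero, one_mul]
      refine if_congr ?_ rfl rfl
      constructor
      · intro h l hl
        rcases Nat.lt_succ_iff_lt_or_eq.1 hl with hl | rfl
        exacts [h l hl, hb]
      · exact fun h l hl => h l (hl.trans (Nat.lt_succ_self s))
    · rw [if_neg fun h => hb (h s (Nat.lt_succ_self s))]
      refine Finset.sum_eq_zero fun nu hn => ?_
      have h0 : nu.card + bet s = 0 := (mem_below.1 hn).2
      omega

/-- Induction on the number of letters of α. The operator U that adds its last letter is moved to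
the β side as its adjoint D, where `removeStrip_signedCount` expands it into the recursion defining
`matrixSum`. -/
theorem cauchy_identity (s : ℕ) (alp : ℕ → ℕ) (r : ℕ) (bet : ℕ → ℕ) :
    ∑ lam ∈ partitions (∑ i ∈ range r, alp i),
      (-1) ^ rowWeight lam * (signedCount bet s lam * signedCount alp r lam)
      = matrixSum s alp r bet := by
  induction r generalizing bet with
  | zero =>
    have h0 : partitions (∑ i ∈ range 0, alp i) = {⊥} := by
      ext nu
      rw [mem_partitions, mem_singleton, ← card_eq_zero_iff, range_zero, sum_empty]
    rw [h0, sum_singleton, signedCount_bot]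
    simp [rowWeight, signedCount, matrixSum]
  | succ r ih =>
    rw [matrixSum]
    simp only [← ih, mul_sum]
    rw [Finset.sum_comm]
    -- This is the adjunction: the weight (-1)^w(λ) cancels against the same factor in `removeStrip`
    -- and leaves (-1)^w(ν).
    have hrem : ∀ lam, ∑ j ∈ subvectors s (alp r) bet, (-1 : ℤ) ^ crossInv s bet j
        * ((-1) ^ rowWeight lam * (signedCount (bet - j) s lam * signedCount alp r lam))
        = ∑ nu ∈ above lam (alp r), (-1) ^ rowWeight nu * (signedCount bet s nu
          * ((-1) ^ stripInv lam nu * signedCount alp r lam)) := by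
      intro lam
      have h := removeStrip_signedCount bet s (alp r) lam
      rw [removeStrip] at h
      have h' := congrArg (fun x => (-1 : ℤ) ^ rowWeight lam * signedCount alp r lam * x) h
      simp only [mul_sum] at h'
      refine (Finset.sum_congr rfl fun j _ => ?_).trans (h'.symm.trans ?_)
      · ring
      refine Finset.sum_congr rfl fun nu _ => ?_
      have hsq : (-1 : ℤ) ^ rowWeight lam * (-1) ^ rowWeight lam = 1 := by
        rw [← mul_pow]; simp
      rw [pow_add, pow_add]
      linear_combination ((-1) ^ rowWeight nu * signedCount bet s nu
          * (-1) ^ stripInv lam nu * signedCount alp r lam) * hsq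
    simp only [hrem, signedCount, addStrip, mul_sum]
    rw [Finset.sum_sigma', Finset.sum_sigma']
    refine Finset.sum_nbij' (fun x => ⟨x.2, x.1⟩) (fun x => ⟨x.2, x.1⟩) ?_ ?_ ?_ ?_ ?_
    · rintro ⟨nu, lam⟩ h
      simp only [mem_sigma, mem_partitions, mem_below, mem_above, sum_range_succ] at h ⊢
      exact ⟨by omega, h.2.1, by omega⟩
    · rintro ⟨lam, nu⟩ h
      simp only [mem_sigma, mem_partitions, mem_below, mem_above, sum_range_succ] at h ⊢
      exact ⟨by omega, h.2.1, by omega⟩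
    all_goals intros; rfl

/-! ### Double cosets and matrices -/

theorem blockOf_mono (alp : List ℕ) : Monotone (blockOf alp) := by
  induction alp with
  | nil => exact fun _ _ _ => le_rfl
  | cons a l ih =>
    intro i j hij
    simp only [blockOf]
    split_ifs with h1 h2
    · exact le_rfl
    · exact Nat.zero_le _
    · omega
    · exact Nat.succ_le_succ (ih (Nat.sub_le_sub_right hij a))

theorem blockOf_lt (alp : List ℕ) {i : ℕ} (h : i < alp.sum) : blockOf alp i < alp.length := by
  induction alp generalizing i with
  | nil => simp at h
  | cons a l ih =>
    rw [List.sum_cons] at h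
    simp only [blockOf, List.length_cons]
    split_ifs with h1
    · omega
    · exact Nat.succ_lt_succ (ih (by omega))

theorem card_blockOf (alp : List ℕ) (t : ℕ) :
    ((range alp.sum).filter fun i => blockOf alp i = t).card = alp.getD t 0 := by
  induction alp generalizing t with
  | nil => simp
  | cons a l ih =>
    rw [List.sum_cons, card_filter, sum_range_add]
    have h1 : ∀ x ∈ range a, (if blockOf (a :: l) x = t then 1 else 0) = if t = 0 then 1 else 0 :=
      fun x hx => by simp [blockOf, mem_range.1 hx, eq_comm]
    rw [sum_congr rfl h1]
    rcases t with _ | t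
    · simp [blockOf]
    · have := ih t
      rw [card_filter] at this
      simpa [blockOf] using this

theorem card_blockOf_fin {n : ℕ} (alp : List ℕ) (h : alp.sum = n) (t : ℕ) :
    (univ.filter fun i : Fin n => blockOf alp i = t).card = alp.getD t 0 := by
  subst h
  rw [← card_blockOf, card_filter, card_filter,
    ← Fin.sum_univ_eq_sum_range (fun i => if blockOf alp i = t then 1 else 0)]

/-- Maps of finite types with fibres of equal sizes differ by a bijection. -/
theorem exists_equiv_of_card_fiber_eq {X Y Z : Type*} [Fintype X] [Fintype Y] [DecidableEq Z]
    (u : X → Z) (v : Y → Z)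
    (h : ∀ z, (univ.filter fun x => u x = z).card = (univ.filter fun y => v y = z).card) :
    ∃ e : X ≃ Y, ∀ x, v (e x) = u x := by
  have he : ∀ z, Nonempty ({x // u x = z} ≃ {y // v y = z}) := fun z => by
    refine ⟨Fintype.equivOfCardEq ?_⟩
    rw [Fintype.card_subtype, Fintype.card_subtype, h]
  exact ⟨Equiv.ofFiberEquiv fun z => (he z).some, fun x => Equiv.ofFiberEquiv_map _ x⟩

section

variable {n : ℕ} (bet alp : List ℕ)

/-- The number of positions of block `t` of `α` that `σ` moves to block `l` of `β`. -/
def blockMatrix (σ : Equiv.Perm (Fin n)) (t l : ℕ) : ℕ :=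
  (univ.filter fun i : Fin n => blockOf alp i = t ∧ blockOf bet (σ i) = l).card

/-- Multiplication by block-preserving permutations does not change the counts. Conversely, equal
counts provide a bijection k with blocks of k(x) and σ(k(x)) equal to those of x and τ(x); then k
lies in S_α and τ k⁻¹ σ⁻¹ in S_β. -/
theorem mk_eq_mk_iff (σ τ : Equiv.Perm (Fin n)) :
    DoubleCoset.mk (parabolic n bet) (parabolic n alp) σ = DoubleCoset.mk _ _ τ ↔
      blockMatrix bet alp σ = blockMatrix bet alp τ := by
  rw [DoubleCoset.eq]
  constructor
  · rintro ⟨h, hh, k, hk, rfl⟩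
    funext t l
    symm
    refine Finset.card_bij (fun i _ => k i) ?_ (fun _ _ _ _ e => k.injective e) ?_
    · intro i hi
      obtain ⟨h1, h2⟩ := (mem_filter.1 hi).2
      refine mem_filter.2 ⟨mem_univ _, (hk i).trans h1, ?_⟩
      rw [← h2]
      exact (hh (σ (k i))).symm
    · intro i hi
      refine ⟨k.symm i, ?_, k.apply_symm_apply i⟩
      obtain ⟨h1, h2⟩ := (mem_filter.1 hi).2
      have h3 := hk (k.symm i)
      rw [k.apply_symm_apply] at h3
      refine mem_filter.2 ⟨mem_univ _, h3.symm.trans h1, ?_⟩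
      rw [Equiv.Perm.mul_apply, Equiv.Perm.mul_apply, k.apply_symm_apply, hh]
      exact h2
  · intro h
    obtain ⟨k, hk⟩ := exists_equiv_of_card_fiber_eq
      (fun i : Fin n => (blockOf alp i, blockOf bet (τ i)))
      (fun i : Fin n => (blockOf alp i, blockOf bet (σ i)))
      (fun z => by
        have := congrFun (congrFun h z.1) z.2
        simp only [blockMatrix] at this
        simp only [Prod.ext_iff]
        exact this.symm)
    simp only [Prod.mk.injEq] at hk
    refine ⟨τ * k⁻¹ * σ⁻¹, fun i => ?_, k, fun i => (hk i).1, ?_⟩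
    · have := (hk (k.symm (σ.symm i))).2
      rw [k.apply_symm_apply, σ.apply_symm_apply] at this
      exact this.symm
    · group

/-- The number of pairs of positions in different blocks of `α` whose order is reversed. -/
def blockInv (σ : Equiv.Perm (Fin n)) : ℕ :=
  (univ.filter fun p : Fin n × Fin n =>
    blockOf alp p.1 < blockOf alp p.2 ∧ blockOf bet (σ p.2) < blockOf bet (σ p.1)).card

theorem blockInv_le (σ : Equiv.Perm (Fin n)) : blockInv bet alp σ ≤ permLength σ := by
  refine Finset.card_le_card fun p => ?_
  simp only [mem_filter, mem_univ, true_and]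
  rintro ⟨h1, h2⟩
  exact ⟨(blockOf_mono alp).reflect_lt h1, (blockOf_mono bet).reflect_lt h2⟩

/-- Together with `blockInv_le` this determines minimal lengths. The representative is increasing
inside each block of α and sends the positions destined for one block of β there in increasing
order, so its only inversions are those forced by the blocks. -/
theorem exists_permLength_le (σ : Equiv.Perm (Fin n)) :
    ∃ τ, DoubleCoset.mk (parabolic n bet) (parabolic n alp) τ = DoubleCoset.mk _ _ σ ∧
      permLength τ ≤ blockInv bet alp τ := by
  let f : Fin n → ℕ := fun i => blockOf alp i
  let g : Fin n → ℕ := fun i => blockOf bet i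
  have hf : Monotone f := fun i j hij => blockOf_mono alp hij
  have hg : Monotone g := fun i j hij => blockOf_mono bet hij
  let h : Fin n → ℕ ×ₗ ℕ := fun i => toLex (f i, g (σ i))
  let k := Tuple.sort h
  have hk : ∀ i j, i ≤ j → f (k i) < f (k j) ∨ f (k i) = f (k j) ∧ g (σ (k i)) ≤ g (σ (k j)) :=
    fun i j hij => (Prod.Lex.toLex_le_toLex.1 (Tuple.monotone_sort h hij))
  -- A nondecreasing rearrangement of the nondecreasing `f` is `f` itself, so `k` preserves the
  -- blocks of α. The same argument gives `hgρ` below.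
  have hfk : f ∘ k = f := by
    refine Tuple.unique_monotone (f := f) (σ := k) (τ := 1) (fun i j hij => ?_) hf
    rcases hk i j hij with h | h
    exacts [h.le, h.1.le]
  let w : Fin n → ℕ := fun i => g (σ (k i))
  have hw : ∀ i j, i ≤ j → f i = f j → w i ≤ w j := fun i j hij e => by
    have e1 := congrFun hfk i
    have e2 := congrFun hfk j
    simp only [Function.comp_apply] at e1 e2
    rcases hk i j hij with h | h
    · omega
    · exact h.2
  -- This sort is stable: positions with equal `w` keep their order. Hence an inversion of `ρ⁻¹` has
  -- distinct values of `w`, and since `w` is nondecreasing on each block of α, its two positions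
  -- lie in different blocks.
  let ρ := Tuple.sort w
  have hρ := (Tuple.eq_sort_iff (f := w) (σ := ρ)).1 rfl
  have hgρ : g ∘ (σ * k * ρ : Equiv.Perm (Fin n)) = g :=
    Tuple.unique_monotone (f := g) (τ := 1) hρ.1 hg
  have hπ : ∀ i, g (ρ⁻¹ i) = w i := fun i => by
    rw [← congrFun hgρ (ρ⁻¹ i)]
    simp [w]
  refine ⟨ρ⁻¹, ?_, Finset.card_le_card fun p => ?_⟩
  · symm
    rw [DoubleCoset.eq]
    refine ⟨(σ * k * ρ)⁻¹, inv_mem fun i => congrFun hgρ i, k, fun i => congrFun hfk i, ?_⟩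
    group
  · simp only [mem_filter, mem_univ, true_and]
    rintro ⟨h1, h2⟩
    have h3 : g (ρ⁻¹ p.2) ≤ g (ρ⁻¹ p.1) := hg h2.le
    have h4 : w p.2 ≠ w p.1 := fun e => by
      have e1 : ∀ i, ρ (ρ⁻¹ i) = i := ρ.apply_symm_apply
      have := hρ.2 _ _ h2 (by rw [e1, e1]; exact e)
      rw [e1, e1] at this
      exact lt_asymm this h1
    have h5 : w p.2 < w p.1 := by
      rw [hπ, hπ] at h3
      omega
    refine ⟨lt_of_le_of_ne (hf h1.le) fun e => ?_, ?_⟩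
    · have := hw _ _ h1.le e
      omega
    · rw [← hπ, ← hπ] at h5
      exact h5

theorem sum_eq_sum_blockMatrix (hb : bet.sum = n) (ha : alp.sum = n) (σ : Equiv.Perm (Fin n))
    (F : ℕ → ℕ → ℕ) :
    ∑ i : Fin n, F (blockOf alp i) (blockOf bet (σ i))
      = ∑ t ∈ range alp.length, ∑ l ∈ range bet.length, blockMatrix bet alp σ t l * F t l := by
  rw [← Finset.sum_product', ← Finset.sum_fiberwise_of_maps_to
    (t := range alp.length ×ˢ range bet.length)
    (g := fun i : Fin n => (blockOf alp i, blockOf bet (σ i)))]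
  · refine Finset.sum_congr rfl fun p _ => ?_
    rw [blockMatrix, ← smul_eq_mul, ← Finset.sum_const]
    refine Finset.sum_congr ?_ fun i hi => ?_
    · ext i
      simp [Prod.ext_iff]
    · simp only [mem_filter] at hi
      rw [hi.2.1, hi.2.2]
  · intro i _
    have h1 := blockOf_lt alp (i := i) (by omega)
    have h2 := blockOf_lt bet (i := σ i) (by omega)
    simp [h1, h2]

end

/-- The number of inversions of a matrix with `r` rows and `s` columns. -/
def matrixInv (s : ℕ) (A : ℕ → ℕ → ℕ) (r : ℕ) : ℕ :=
  ∑ t ∈ range r, ∑ m ∈ range s, (∑ l ∈ range m, A t l) * ∑ t' ∈ range t, A t' m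

theorem sum_range_ite_lt (F : ℕ → ℕ) {r t : ℕ} (h : t ≤ r) :
    ∑ x ∈ range r, (if x < t then F x else 0) = ∑ x ∈ range t, F x := by
  rw [← Finset.sum_filter]
  congr 1
  ext x
  simp only [mem_filter, mem_range]
  omega

theorem blockInv_eq {n : ℕ} (bet alp : List ℕ) (hb : bet.sum = n) (ha : alp.sum = n)
    (σ : Equiv.Perm (Fin n)) :
    blockInv bet alp σ = matrixInv bet.length (blockMatrix bet alp σ) alp.length := by
  rw [blockInv, card_filter, Fintype.sum_prod_type, Finset.sum_comm]
  have h1 : ∀ i' : Fin n, ∑ i : Fin n, (if blockOf alp i < blockOf alp i' ∧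
      blockOf bet (σ i') < blockOf bet (σ i) then 1 else 0)
      = (fun t l => ∑ t' ∈ range alp.length, ∑ m ∈ range bet.length,
          blockMatrix bet alp σ t' m * if t' < t ∧ l < m then 1 else 0)
        (blockOf alp i') (blockOf bet (σ i')) := fun i' =>
    sum_eq_sum_blockMatrix bet alp hb ha σ
      (fun t' m => if t' < blockOf alp i' ∧ blockOf bet (σ i') < m then 1 else 0)
  refine (Finset.sum_congr rfl fun i' _ => h1 i').trans ?_
  refine (sum_eq_sum_blockMatrix bet alp hb ha σ fun t l =>
    ∑ t' ∈ range alp.length, ∑ m ∈ range bet.length,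
      blockMatrix bet alp σ t' m * if t' < t ∧ l < m then 1 else 0).trans ?_
  rw [matrixInv]
  refine Finset.sum_congr rfl fun t ht => ?_
  have h2 : ∀ m ∈ range bet.length,
      (∑ l ∈ range m, blockMatrix bet alp σ t l) * ∑ t' ∈ range t, blockMatrix bet alp σ t' m
      = ∑ l ∈ range bet.length, ∑ t' ∈ range alp.length, blockMatrix bet alp σ t l *
          (blockMatrix bet alp σ t' m * if t' < t ∧ l < m then 1 else 0) := by
    intro m hm
    rw [← sum_range_ite_lt _ (mem_range.1 hm).le, ← sum_range_ite_lt _ (mem_range.1 ht).le,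
      Finset.sum_mul_sum]
    refine Finset.sum_congr rfl fun l _ => Finset.sum_congr rfl fun t' _ => ?_
    by_cases h3 : l < m <;> by_cases h4 : t' < t <;> simp [h3, h4]
  rw [Finset.sum_congr rfl h2, Finset.sum_comm]
  refine Finset.sum_congr rfl fun l _ => ?_
  rw [Finset.sum_comm, mul_sum]
  exact Finset.sum_congr rfl fun t' _ => mul_sum _ _ _

/-- `blockInv` depends only on the matrix, hence only on the coset; it bounds every length in the
coset from below and is attained. -/
theorem cosetLength_mk {n : ℕ} (bet alp : List ℕ) (hb : bet.sum = n) (ha : alp.sum = n)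
    (σ : Equiv.Perm (Fin n)) :
    cosetLength (DoubleCoset.mk (parabolic n bet) (parabolic n alp) σ)
      = matrixInv bet.length (blockMatrix bet alp σ) alp.length := by
  rw [cosetLength]
  apply le_antisymm
  · obtain ⟨τ, h1, h2⟩ := exists_permLength_le bet alp σ
    rw [blockInv_eq bet alp hb ha, (mk_eq_mk_iff bet alp τ σ).1 h1] at h2
    exact (Nat.sInf_le (Set.mem_image_of_mem permLength h1)).trans h2
  · refine le_csInf ⟨_, Set.mem_image_of_mem permLength rfl⟩ ?_
    rintro _ ⟨τ, h1, rfl⟩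
    have h2 := blockInv_le bet alp τ
    rwa [blockInv_eq bet alp hb ha, (mk_eq_mk_iff bet alp τ σ).1 h1] at h2

/-- `A` is a matrix with `r` rows and `s` columns, extended by zero, with row sums `α` and column
sums `β`. -/
structure HasMargins (r s : ℕ) (alp bet : ℕ → ℕ) (A : ℕ → ℕ → ℕ) : Prop where
  row_sum : ∀ t < r, ∑ l ∈ range s, A t l = alp t
  col_sum : ∀ l, ∑ t ∈ range r, A t l = bet l
  row_zero : ∀ t l, r ≤ t → A t l = 0
  col_zero : ∀ t l, s ≤ l → A t l = 0

/-- Fibring over the last row j leaves matrices with column sums β - j. The inversions that involve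
the last row pair its entries with the remaining column sums, which is `crossInv`. -/
theorem sum_matrixInv (r s : ℕ) (alp bet : ℕ → ℕ) (hbet : ∀ l, s ≤ l → bet l = 0)
    (S : Finset (ℕ → ℕ → ℕ)) (hS : ∀ A, A ∈ S ↔ HasMargins r s alp bet A) :
    ∑ A ∈ S, (-1 : ℤ) ^ matrixInv s A r = matrixSum s alp r bet := by
  classical
  induction r generalizing bet S with
  | zero =>
    rw [show matrixSum s alp 0 bet = if ∀ l < s, bet l = 0 then 1 else 0 from rfl]
    split_ifs with h
    · have : S = {0} := by
        ext A
        rw [hS, mem_singleton]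
        constructor
        · intro hA
          funext t l
          exact hA.row_zero t l (Nat.zero_le t)
        · rintro rfl
          refine ⟨fun t ht => by omega, fun l => ?_, fun _ _ _ => rfl, fun _ _ _ => rfl⟩
          rcases lt_or_ge l s with hl | hl
          · simp [h l hl]
          · simp [hbet l hl]
      rw [this, sum_singleton]
      simp [matrixInv]
    · have : S = ∅ := by
        ext A
        rw [hS]
        refine ⟨fun hA => absurd (fun l _ => ?_) h, fun hA => absurd hA (notMem_empty A)⟩
        simpa using (hA.col_sum l).symm
      rw [this, sum_empty]
  | succ r ih =>
    rw [matrixSum, ← Finset.sum_fiberwise_of_maps_to (g := fun A : ℕ → ℕ → ℕ => A r)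
      (t := subvectors s (alp r) bet)]
    · refine Finset.sum_congr rfl fun j hj => ?_
      obtain ⟨j1, j2, j3⟩ := mem_subvectors.1 hj
      have hup : ∀ A : ℕ → ℕ → ℕ, ∀ v l, ∑ t ∈ range r, Function.update A r v t l
          = ∑ t ∈ range r, A t l := fun A v l =>
        Finset.sum_congr rfl fun t ht => by
          rw [Function.update_of_ne (by have := mem_range.1 ht; omega)]
      -- The induction hypothesis is applied to the fibre over j with row r replaced by zero; this
      -- replacement is injective on the fibre, since row r is j throughout.
      rw [← ih (bet - j) (fun l hl => by simp [hbet l hl])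
        ((S.filter fun A => A r = j).image fun A => Function.update A r 0), sum_image, mul_sum]
      · refine Finset.sum_congr rfl fun A hA => ?_
        rw [mem_filter, hS] at hA
        obtain ⟨hA, rfl⟩ := hA
        rw [← pow_add]
        congr 1
        rw [matrixInv, sum_range_succ, add_comm]
        congr 1
        · refine Finset.sum_congr rfl fun m _ => ?_
          congr 1
          have := hA.col_sum m
          rw [sum_range_succ] at this
          omega
        · refine Finset.sum_congr rfl fun t ht => Finset.sum_congr rfl fun m _ => ?_
          have ht := mem_range.1 ht
          congr 1
          · rw [Function.update_of_ne (by omega)]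
          · refine Finset.sum_congr rfl fun t' ht' => ?_
            have ht' := mem_range.1 ht'
            rw [Function.update_of_ne (by omega)]
      · intro A hA B hB h
        simp only [coe_filter, Set.mem_ofPred_eq] at hA hB
        replace h : Function.update A r 0 = Function.update B r 0 := h
        rw [← Function.update_eq_self r A, ← Function.update_eq_self r B, hA.2, hB.2,
          ← Function.update_idem (v := 0) (w := j) (f := A), h, Function.update_idem]
      · intro A
        rw [mem_image]
        constructor
        · rintro ⟨B, hB, rfl⟩
          rw [mem_filter, hS] at hB
          obtain ⟨hB, rfl⟩ := hB
          refine ⟨fun t ht => ?_, fun l => ?_, fun t l ht => ?_, fun t l hl => ?_⟩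
          · rw [Function.update_of_ne (by omega)]
            exact hB.row_sum t (by omega)
          · rw [hup, Pi.sub_apply, ← hB.col_sum l, sum_range_succ, Nat.add_sub_cancel]
          · rcases eq_or_ne t r with rfl | hne
            · simp
            · rw [Function.update_of_ne hne]
              exact hB.row_zero t l (by omega)
          · rcases eq_or_ne t r with rfl | hne
            · simp
            · rw [Function.update_of_ne hne]
              exact hB.col_zero t l hl
        · intro hA
          have h0 : A r = 0 := funext fun l => hA.row_zero r l le_rfl
          refine ⟨Function.update A r j, ?_, ?_⟩
          · rw [mem_filter, hS, Function.update_self]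
            refine ⟨⟨fun t ht => ?_, fun l => ?_, fun t l ht => ?_, fun t l hl => ?_⟩, rfl⟩
            · rcases eq_or_ne t r with rfl | hne
              · rw [Function.update_self, j1]
              · rw [Function.update_of_ne hne]
                exact hA.row_sum t (by omega)
            · rw [sum_range_succ, hup, hA.col_sum, Function.update_self, Pi.sub_apply]
              have : j l ≤ bet l := j3 l
              omega
            · rw [Function.update_of_ne (by omega)]
              exact hA.row_zero t l (by omega)
            · rcases eq_or_ne t r with rfl | hne
              · rw [Function.update_self, j2 l hl]
              · rw [Function.update_of_ne hne]
                exact hA.col_zero t l hl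
          · rw [Function.update_idem, ← h0, Function.update_eq_self]
    · intro A hA
      rw [hS] at hA
      rw [mem_subvectors]
      refine ⟨hA.row_sum r (Nat.lt_succ_self r), fun l hl => hA.col_zero r l hl, fun l => ?_⟩
      rw [← hA.col_sum l, sum_range_succ]
      exact Nat.le_add_left _ _

theorem hasMargins_blockMatrix {n : ℕ} (bet alp : List ℕ) (hb : bet.sum = n) (ha : alp.sum = n)
    (σ : Equiv.Perm (Fin n)) :
    HasMargins alp.length bet.length (alp.getD · 0) (bet.getD · 0) (blockMatrix bet alp σ) := by
  have hat : ∀ i : Fin n, blockOf alp i < alp.length := fun i => blockOf_lt alp (by omega)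
  have hbt : ∀ i : Fin n, blockOf bet i < bet.length := fun i => blockOf_lt bet (by omega)
  refine ⟨fun t _ => ?_, fun l => ?_, fun t l ht => ?_, fun t l hl => ?_⟩
  · rw [← card_blockOf_fin alp ha, Finset.card_eq_sum_card_fiberwise
      (f := fun i => blockOf bet (σ i)) (t := range bet.length)]
    · simp only [filter_filter, blockMatrix]
    · intro i _
      exact mem_coe.2 (mem_range.2 (hbt (σ i)))
  · have h1 : (univ.filter fun i : Fin n => blockOf bet (σ i) = l).card = bet.getD l 0 := by
      rw [← card_blockOf_fin bet hb]
      refine Finset.card_bij (fun i _ => σ i) ?_ (fun _ _ _ _ e => σ.injective e) ?_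
      · intro i hi
        simpa using hi
      · intro i hi
        exact ⟨σ.symm i, by simpa using hi, σ.apply_symm_apply i⟩
    rw [← h1, Finset.card_eq_sum_card_fiberwise
      (f := fun i : Fin n => blockOf alp i) (t := range alp.length)]
    · simp only [filter_filter, blockMatrix, and_comm]
    · intro i _
      exact mem_coe.2 (mem_range.2 (hat i))
  · refine Finset.card_eq_zero.2 (Finset.filter_eq_empty_iff.2 fun i _ h => ?_)
    have := hat i
    omega
  · refine Finset.card_eq_zero.2 (Finset.filter_eq_empty_iff.2 fun i _ h => ?_)
    have := hbt (σ i)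
    omega

/-- Take a set with A_{tl} elements labelled (t, l). The margins allow the positions to be matched
with it compatibly with the row labels, and also with the column labels; σ is the first matching
followed by the inverse of the second. -/
theorem exists_blockMatrix_eq {n : ℕ} (bet alp : List ℕ) (hb : bet.sum = n) (ha : alp.sum = n)
    {A : ℕ → ℕ → ℕ}
    (hA : HasMargins alp.length bet.length (alp.getD · 0) (bet.getD · 0) A) :
    ∃ σ : Equiv.Perm (Fin n), blockMatrix bet alp σ = A := by
  let X := Σ p : Fin alp.length × Fin bet.length, Fin (A p.1 p.2)
  have hcount : ∀ (φ : ℕ → ℕ → Prop) [∀ t l, Decidable (φ t l)],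
      (univ.filter fun x : X => φ x.1.1 x.1.2).card
        = ∑ t ∈ range alp.length, ∑ l ∈ range bet.length, if φ t l then A t l else 0 := by
    intro φ _
    rw [card_filter, Fintype.sum_sigma, Fintype.sum_prod_type,
      ← Fin.sum_univ_eq_sum_range
        (fun t => ∑ l ∈ range bet.length, if φ t l then A t l else 0)]
    refine Finset.sum_congr rfl fun t _ => ?_
    rw [← Fin.sum_univ_eq_sum_range (fun l => if φ t l then A t l else 0)]
    refine Finset.sum_congr rfl fun l _ => ?_
    split_ifs <;> simp
  obtain ⟨e1, he1⟩ := exists_equiv_of_card_fiber_eq (fun i : Fin n => blockOf alp i)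
    (fun x : X => (x.1.1 : ℕ)) (fun t => by
      rw [card_blockOf_fin alp ha, hcount (fun t' _ => t' = t), Finset.sum_comm]
      simp only [Finset.sum_ite_eq', mem_range]
      split_ifs with ht
      · exact (hA.row_sum t ht).symm
      · simp [not_lt.1 ht])
  obtain ⟨e2, he2⟩ := exists_equiv_of_card_fiber_eq (fun i : Fin n => blockOf bet i)
    (fun x : X => (x.1.2 : ℕ)) (fun l => by
      rw [card_blockOf_fin bet hb, hcount (fun _ l' => l' = l)]
      simp only [Finset.sum_ite_eq', mem_range]
      split_ifs with hl
      · exact (hA.col_sum l).symm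
      · simp [not_lt.1 hl])
  refine ⟨e1.trans e2.symm, ?_⟩
  funext t l
  have h1 : blockMatrix bet alp (e1.trans e2.symm) t l
      = (univ.filter fun x : X => (x.1.1 : ℕ) = t ∧ (x.1.2 : ℕ) = l).card := by
    refine Finset.card_bij (fun i _ => e1 i) ?_ (fun _ _ _ _ e => e1.injective e) ?_
    · intro i hi
      obtain ⟨h1, h2⟩ := (mem_filter.1 hi).2
      refine mem_filter.2 ⟨mem_univ _, (he1 i).trans h1, ?_⟩
      rw [← h2, ← he2]
      simp
    · intro x hx
      obtain ⟨h1, h2⟩ := (mem_filter.1 hx).2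
      refine ⟨e1.symm x, mem_filter.2 ⟨mem_univ _, ?_, ?_⟩, e1.apply_symm_apply x⟩
      · rw [← h1, ← he1]
        simp
      · rw [← h2, ← he2]
        simp
  rw [h1, hcount (fun t' l' => t' = t ∧ l' = l)]
  simp only [ite_and, Finset.sum_ite_irrel, Finset.sum_ite_eq', Finset.sum_const_zero, mem_range]
  split_ifs with h2 h3
  · rfl
  · exact (hA.col_zero t l (not_lt.1 h3)).symm
  · exact (hA.row_zero t l (not_lt.1 h2)).symm

theorem pairing_eq_matrixSum (bet alp : List ℕ) (h : bet.sum = alp.sum) :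
    pairing bet alp = matrixSum bet.length (alp.getD · 0) alp.length (bet.getD · 0) := by
  classical
  rw [pairing, if_pos h, ← sum_matrixInv _ _ _ _ (fun l hl => by simp [hl])
    (univ.image fun σ : Equiv.Perm (Fin alp.sum) => blockMatrix bet alp σ)]
  · refine Finset.sum_bij (fun c _ => blockMatrix bet alp (Quotient.out c)) ?_ ?_ ?_ ?_
    · intro c _
      exact mem_image_of_mem _ (mem_univ _)
    · intro c _ d _ e
      rw [← DoubleCoset.out_eq' _ _ c, ← DoubleCoset.out_eq' _ _ d]
      exact (mk_eq_mk_iff bet alp _ _).2 e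
    · intro A hA
      obtain ⟨σ, -, rfl⟩ := mem_image.1 hA
      refine ⟨DoubleCoset.mk _ _ σ, mem_univ _, ?_⟩
      exact (mk_eq_mk_iff bet alp _ _).1 (DoubleCoset.out_eq' _ _ _)
    · intro c _
      conv_lhs => rw [← DoubleCoset.out_eq' _ _ c]
      rw [cosetLength_mk bet alp h rfl]
  · intro A
    rw [mem_image]
    constructor
    · rintro ⟨σ, -, rfl⟩
      exact hasMargins_blockMatrix bet alp h rfl σ
    · intro hA
      obtain ⟨σ, hσ⟩ := exists_blockMatrix_eq bet alp h rfl hA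
      exact ⟨σ, mem_univ _, hσ⟩

/-! ### Signs of words and tableaux -/

/-- The number of inversions of a word. -/
def wordInv : List ℕ → ℕ
  | [] => 0
  | a :: l => l.countP (· < a) + wordInv l

theorem wordInv_eq_card (w : List ℕ) :
    wordInv w = (univ.filter fun p : Fin w.length × Fin w.length =>
      p.1 < p.2 ∧ w.get p.2 < w.get p.1).card := by
  induction w with
  | nil => rfl
  | cons a l ih =>
    rw [wordInv, ih, card_filter, card_filter, Fintype.sum_prod_type, Fintype.sum_prod_type]
    simp only [List.length_cons, Fin.sum_univ_succ]
    have h1 : l.countP (· < a) = ∑ i : Fin l.length, if l.get i < a then 1 else 0 := by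
      clear ih
      induction l with
      | nil => rfl
      | cons b l ih =>
        rw [List.countP_cons, ih]
        simp only [List.length_cons, Fin.sum_univ_succ]
        by_cases h : b < a <;> simp [h, add_comm]
    rw [h1]
    simp

/-- Any sorting permutation must reverse every inversion of the word, and the stable sort reverses
nothing else. -/
theorem wordSign_eq (w : List ℕ) : wordSign w = (-1) ^ wordInv w := by
  rw [wordSign, wordInv_eq_card]
  congr 1
  have hsort := (Tuple.eq_sort_iff (f := w.get) (σ := Tuple.sort w.get)).1 rfl
  apply le_antisymm
  · refine (Nat.sInf_le (Set.mem_image_of_mem permLength hsort.1)).trans ?_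
    refine Finset.card_le_card_of_injOn
      (fun p => (Tuple.sort w.get p.2, Tuple.sort w.get p.1)) ?_ ?_
    · intro p hp
      obtain ⟨h1, h2⟩ := (mem_filter.1 (mem_coe.1 hp)).2
      refine mem_coe.2 (mem_filter.2 ⟨mem_univ _, h2, lt_of_le_of_ne (hsort.1 h1.le) fun e => ?_⟩)
      exact lt_asymm h2 (hsort.2 _ _ h1 e)
    · rintro ⟨i, j⟩ _ ⟨i', j'⟩ _ e
      simpa [and_comm] using e
  · refine le_csInf ⟨_, Set.mem_image_of_mem permLength hsort.1⟩ ?_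
    rintro _ ⟨σ, hσ, rfl⟩
    refine Finset.card_le_card_of_injOn (fun p => (σ.symm p.2, σ.symm p.1)) ?_ ?_
    · intro p hp
      obtain ⟨h1, h2⟩ := (mem_filter.1 (mem_coe.1 hp)).2
      refine mem_coe.2 (mem_filter.2 ⟨mem_univ _, ?_, by simpa using h1⟩)
      by_contra h3
      have := hσ (not_lt.1 h3)
      simp only [Function.comp_apply, Equiv.apply_symm_apply] at this
      exact absurd h2 (not_lt.2 this)
    · rintro ⟨i, j⟩ _ ⟨i', j'⟩ _ e
      simpa [and_comm] using e

theorem wordInv_append (l l' : List ℕ) :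
    wordInv (l ++ l') = wordInv l + wordInv l' + (l.map fun a => l'.countP (· < a)).sum := by
  induction l with
  | nil => simp [wordInv]
  | cons a l ih =>
    simp only [List.cons_append, wordInv, ih, List.countP_append, List.map_cons, List.sum_cons]
    omega

theorem wordInv_of_sorted {l : List ℕ} (h : l.Pairwise (· ≤ ·)) : wordInv l = 0 := by
  induction l with
  | nil => rfl
  | cons a l ih =>
    rw [List.pairwise_cons] at h
    rw [wordInv, ih h.2, add_zero, List.countP_eq_zero]
    intro b hb
    simpa using h.1 b hb

/-- The number of inversions of the row word of a tableau. -/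
def tableauInv {lam : YoungDiagram} (T : SemistandardYoungTableau lam) : ℕ :=
  ∑ x ∈ lam.cells, ∑ y ∈ lam.cells, if y.1 < x.1 ∧ T y.1 y.2 < T x.1 x.2 then 1 else 0

theorem sum_map_range {M : Type*} [AddCommMonoid M] (n : ℕ) (F : ℕ → M) :
    ((List.range n).map F).sum = ∑ i ∈ range n, F i := by
  induction n with
  | zero => rfl
  | succ n ih => simp [List.range_succ, sum_range_succ, ih]

theorem countP_map_range (n : ℕ) (F : ℕ → ℕ) (a : ℕ) :
    ((List.range n).map F).countP (· < a) = ∑ i ∈ range n, if F i < a then 1 else 0 := by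
  induction n with
  | zero => rfl
  | succ n ih =>
    rw [List.range_succ, List.map_append, List.countP_append, ih, sum_range_succ]
    simp [List.countP_cons]

/-- Rows are weakly increasing, so inversions occur only between different rows; lower rows come
first in the word. -/
theorem wordInv_rows {lam : YoungDiagram} (T : SemistandardYoungTableau lam) (R : ℕ) :
    wordInv ((List.range R).reverse.flatMap fun i => (List.range (lam.rowLen i)).map fun j => T i j)
      = ∑ i ∈ range R, ∑ j ∈ range (lam.rowLen i), ∑ i' ∈ range i, ∑ j' ∈ range (lam.rowLen i'),
          if T i' j' < T i j then 1 else 0 := by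
  have hcount : ∀ R a, ((List.range R).reverse.flatMap fun i =>
      (List.range (lam.rowLen i)).map fun j => T i j).countP (· < a)
      = ∑ i' ∈ range R, ∑ j' ∈ range (lam.rowLen i'), if T i' j' < a then 1 else 0 := by
    intro R a
    induction R with
    | zero => rfl
    | succ R ih =>
      rw [List.range_succ, List.reverse_append, List.reverse_singleton, List.singleton_append,
        List.flatMap_cons, List.countP_append, ih, sum_range_succ, countP_map_range, add_comm]
  induction R with
  | zero => rfl
  | succ R ih =>
    rw [List.range_succ, List.reverse_append, List.reverse_singleton, List.singleton_append,
        List.flatMap_cons, wordInv_append, ih, sum_range_succ, wordInv_of_sorted, zero_add]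
    · congr 1
      rw [List.map_map, sum_map_range]
      exact Finset.sum_congr rfl fun j _ => hcount R _
    · rw [List.pairwise_map]
      refine (List.pairwise_lt_range).imp_of_mem fun {a b} _ hb h => ?_
      exact T.row_weak h (YoungDiagram.mem_iff_lt_rowLen.2 (List.mem_range.1 hb))

theorem tableauSign_eq {lam : YoungDiagram} (T : SemistandardYoungTableau lam) :
    tableauSign T = (-1) ^ tableauInv T := by
  rw [tableauSign, wordSign_eq, rowWord, wordInv_rows]
  congr 1
  rw [tableauInv, sum_cells lam le_rfl (fun i j => ∑ y ∈ lam.cells,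
    if y.1 < i ∧ T y.1 y.2 < T i j then 1 else 0)]
  refine Finset.sum_congr rfl fun i hi => Finset.sum_congr rfl fun j _ => ?_
  rw [sum_cells lam le_rfl (fun i' j' => if i' < i ∧ T i' j' < T i j then 1 else 0),
    ← sum_range_ite_lt _ (mem_range.1 hi).le]
  refine Finset.sum_congr rfl fun i' _ => ?_
  by_cases h : i' < i <;> simp [h]

/-! ### Removal of the largest letter -/

theorem finite_letterTableaux (lam : YoungDiagram) (c : ℕ → ℕ) (r : ℕ) :
    {T : SemistandardYoungTableau lam | (∀ x ∈ lam.cells, T x.1 x.2 < r) ∧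
      ∀ i < r, (lam.cells.filter fun x => T x.1 x.2 = i).card = c i}.Finite := by
  let p : SemistandardYoungTableau lam → (lam.cells → ℕ) := fun T x => T x.1.1 x.1.2
  have hinj : Function.Injective p := by
    intro T T' h
    apply SemistandardYoungTableau.ext
    intro i j
    by_cases hij : (i, j) ∈ lam
    · exact congrFun h ⟨(i, j), hij⟩
    · rw [T.zeros hij, T'.zeros hij]
  refine Set.Finite.of_finite_image (f := p) (Set.Finite.subset
    (Set.Finite.pi' (t := fun _ : lam.cells => Set.Iio r)
      fun _ => Set.finite_Iio _) ?_) hinj.injOn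
  rintro _ ⟨T, hT, rfl⟩ x
  exact hT.1 x.1 x.2

/-- The semistandard tableaux of shape `λ` with letters `i < r`, each occurring `c i` times. -/
noncomputable def letterTableaux (lam : YoungDiagram) (c : ℕ → ℕ) (r : ℕ) :
    Finset (SemistandardYoungTableau lam) :=
  (finite_letterTableaux lam c r).toFinset

theorem mem_letterTableaux {lam : YoungDiagram} {c : ℕ → ℕ} {r : ℕ}
    {T : SemistandardYoungTableau lam} :
    T ∈ letterTableaux lam c r ↔ (∀ x ∈ lam.cells, T x.1 x.2 < r) ∧
      ∀ i < r, (lam.cells.filter fun x => T x.1 x.2 = i).card = c i := by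
  simp [letterTableaux]

/-- The cells of a tableau with entries smaller than `r`. -/
def sublevel {lam : YoungDiagram} (T : SemistandardYoungTableau lam) (r : ℕ) : YoungDiagram where
  cells := lam.cells.filter fun x => T x.1 x.2 < r
  isLowerSet := by
    rintro ⟨i, j⟩ ⟨i', j'⟩ h hx
    obtain ⟨h1, h2⟩ := Prod.mk_le_mk.1 h
    simp only [coe_filter, Set.mem_ofPred_eq] at hx ⊢
    have hx1 : (i, j) ∈ lam := hx.1
    have hx2 : (i', j) ∈ lam := lam.up_left_mem h1 le_rfl hx1
    exact ⟨lam.up_left_mem h1 h2 hx1,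
      ((T.row_weak_of_le h2 hx2).trans (T.col_weak h1 hx1)).trans_lt hx.2⟩

/-- The restriction of a tableau to a smaller diagram. -/
def restrict {lam : YoungDiagram} (T : SemistandardYoungTableau lam) {kap : YoungDiagram}
    (h : kap ≤ lam) : SemistandardYoungTableau kap where
  entry i j := if (i, j) ∈ kap then T i j else 0
  row_weak' hj hc := by
    rw [if_pos hc, if_pos (kap.up_left_mem le_rfl hj.le hc)]
    exact T.row_weak hj (h hc)
  col_strict' hi hc := by
    rw [if_pos hc, if_pos (kap.up_left_mem hi.le le_rfl hc)]
    exact T.col_strict hi (h hc)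
  zeros' hc := if_neg hc

theorem restrict_apply {lam kap : YoungDiagram} (T : SemistandardYoungTableau lam) (h : kap ≤ lam)
    {i j : ℕ} (hc : (i, j) ∈ kap) : restrict T h i j = T i j :=
  if_pos hc

theorem HStrip.le {kap lam : YoungDiagram} (h : HStrip kap lam) : kap ≤ lam := by
  intro c hc
  have hc' : (c.1, c.2) ∈ kap := hc
  change (c.1, c.2) ∈ lam
  rw [YoungDiagram.mem_iff_lt_rowLen] at hc' ⊢
  exact hc'.trans_le (h c.1).2

theorem stripInv_eq_sum {kap lam : YoungDiagram} (h : HStrip kap lam) :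
    stripInv kap lam
      = ∑ x ∈ lam.cells \ kap.cells, ∑ y ∈ kap.cells, if y.1 < x.1 then 1 else 0 := by
  have h1 : ∀ x ∈ lam.cells, (∑ y ∈ kap.cells, if y.1 < x.1 then 1 else 0)
      = ∑ l ∈ range x.1, kap.rowLen l := by
    rintro ⟨i, j⟩ hx
    have hi : i ≤ lam.colLen 0 := by
      have hx' : (i, j) ∈ lam := hx
      exact (YoungDiagram.mem_iff_lt_colLen.1 (lam.up_left_mem le_rfl (Nat.zero_le j) hx')).le
    rw [sum_cells kap h.colLen_le (fun l _ => if l < i then 1 else 0), ← sum_range_ite_lt _ hi]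
    refine Finset.sum_congr rfl fun l _ => ?_
    simp
  have hsub : kap.cells ⊆ lam.cells := YoungDiagram.cells_subset_iff.2 h.le
  rw [Finset.sum_congr rfl fun x hx => h1 x (mem_sdiff.1 hx).1]
  have h2 := Finset.sum_sdiff hsub (f := fun x => ∑ l ∈ range x.1, kap.rowLen l)
  rw [sum_cells kap h.colLen_le (fun i _ => ∑ l ∈ range i, kap.rowLen l),
    sum_cells lam le_rfl (fun i _ => ∑ l ∈ range i, kap.rowLen l)] at h2
  have h3 : stripInv kap lam + ∑ i ∈ range (lam.colLen 0), ∑ j ∈ range (kap.rowLen i),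
      ∑ l ∈ range i, kap.rowLen l
      = ∑ i ∈ range (lam.colLen 0), ∑ j ∈ range (lam.rowLen i), ∑ l ∈ range i, kap.rowLen l := by
    rw [stripInv, ← sum_add_distrib]
    refine Finset.sum_congr rfl fun i _ => ?_
    rw [sum_const, sum_const, card_range, card_range, smul_eq_mul, smul_eq_mul, ← add_mul,
      Nat.sub_add_cancel (h i).2]
  omega

/-- A strip cell, carrying the largest letter, forms an inversion with precisely the cells of κ in
higher rows, and never as the smaller entry of a pair. -/
theorem tableauInv_eq_add {lam kap : YoungDiagram} (T : SemistandardYoungTableau lam) {r : ℕ}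
    (h : HStrip kap lam) (hk : ∀ x ∈ kap.cells, T x.1 x.2 < r)
    (hl : ∀ x ∈ lam.cells \ kap.cells, T x.1 x.2 = r) :
    tableauInv T = stripInv kap lam + tableauInv (restrict T h.le) := by
  have hsub : kap.cells ⊆ lam.cells := YoungDiagram.cells_subset_iff.2 h.le
  rw [stripInv_eq_sum h, tableauInv, ← Finset.sum_sdiff hsub]
  congr 1
  · refine Finset.sum_congr rfl fun x hx => ?_
    rw [← Finset.sum_sdiff hsub, hl x hx, Finset.sum_eq_zero, zero_add]
    · exact Finset.sum_congr rfl fun y hy => by simp [hk y hy]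
    · intro y hy
      rw [hl y hy]
      simp
  · refine Finset.sum_congr rfl fun x hx => ?_
    rw [← Finset.sum_sdiff hsub, Finset.sum_eq_zero, zero_add]
    · exact Finset.sum_congr rfl fun y hy => by rw [restrict_apply T h.le hx, restrict_apply T h.le hy]
    · intro y hy
      have := hk x hx
      rw [hl y hy, if_neg (by omega)]

/-- The extension of a tableau by a horizontal strip that is filled with `r`. -/
def extend {kap lam : YoungDiagram} (T : SemistandardYoungTableau kap) (h : HStrip kap lam) (r : ℕ)
    (hT : ∀ x ∈ kap.cells, T x.1 x.2 < r) : SemistandardYoungTableau lam where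
  entry i j := if (i, j) ∈ kap then T i j else if (i, j) ∈ lam then r else 0
  row_weak' {i j1 j2} hj hc := by
    rw [if_pos hc]
    by_cases h2 : (i, j2) ∈ kap
    · rw [if_pos h2, if_pos (kap.up_left_mem le_rfl hj.le h2)]
      exact T.row_weak hj h2
    · rw [if_neg h2, if_pos (lam.up_left_mem le_rfl hj.le hc)]
      split_ifs with h1
      · exact (hT _ h1).le
      · exact le_rfl
  col_strict' {i1 i2 j} hi hc := by
    have h1 : (i1, j) ∈ kap := by
      rw [YoungDiagram.mem_iff_lt_rowLen] at hc ⊢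
      exact (hc.trans_le (lam.rowLen_anti (i1 + 1) i2 hi)).trans_le (h i1).1
    rw [if_pos hc, if_pos h1]
    split_ifs with h2
    · exact T.col_strict hi h2
    · exact hT _ h1
  zeros' {i j} hc := by
    rw [if_neg hc, if_neg fun h' => hc (h.le h')]

/-- Induction on the number of letters: a tableau corresponds to the subdiagram of its smaller
entries together with its restriction to it. Column strictness says that the cells with the largest
letter form a horizontal strip. -/
theorem sum_letterTableaux (c : ℕ → ℕ) (r : ℕ) (lam : YoungDiagram) :
    ∑ T ∈ letterTableaux lam c r, (-1 : ℤ) ^ tableauInv T = signedCount c r lam := by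
  classical
  induction r generalizing lam with
  | zero =>
    rw [signedCount_zero]
    split_ifs with h
    · subst h
      have hT : ∀ T : SemistandardYoungTableau ⊥, T = default := fun T =>
        SemistandardYoungTableau.ext fun i j => by
          rw [T.zeros (YoungDiagram.notMem_bot _),
            SemistandardYoungTableau.zeros _ (YoungDiagram.notMem_bot _)]
      rw [Finset.sum_eq_single_of_mem default]
      · simp [tableauInv]
      · rw [mem_letterTableaux]
        simp
      · exact fun T _ h => absurd (hT T) h
    · refine Finset.sum_eq_zero fun T hT => absurd ?_ h
      rw [mem_letterTableaux] at hT
      refine (card_eq_zero_iff lam).1 (Finset.card_eq_zero.2 (Finset.eq_empty_of_forall_notMem ?_))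
      intro x hx
      exact absurd (hT.1 x hx) (Nat.not_lt_zero _)
  | succ r ih =>
    have hfib : ∀ T ∈ letterTableaux lam c (r + 1), ∀ x ∈ lam.cells \ (sublevel T r).cells,
        T x.1 x.2 = r := by
      intro T hT x hx
      have h1 := (mem_letterTableaux.1 hT).1 x (mem_sdiff.1 hx).1
      have h2 : ¬ T x.1 x.2 < r := fun h =>
        (mem_sdiff.1 hx).2 (mem_filter.2 ⟨(mem_sdiff.1 hx).1, h⟩)
      omega
    rw [signedCount, addStrip, ← Finset.sum_fiberwise_of_maps_to (g := fun T => sublevel T r)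
      (t := below lam (c r))]
    · refine Finset.sum_congr rfl fun kap hkap => ?_
      obtain ⟨hs, hcard⟩ := mem_below.1 hkap
      rw [← ih kap, mul_sum]
      refine Finset.sum_bij (fun T _ => restrict T hs.le) ?_ ?_ ?_ ?_
      · intro T hT
        obtain ⟨h0, rfl⟩ := mem_filter.1 hT
        clear hT
        have hT := mem_letterTableaux.1 h0
        rw [mem_letterTableaux]
        refine ⟨fun x hx => ?_, fun i hi => ?_⟩
        · rw [restrict_apply T hs.le hx]
          exact (mem_filter.1 hx).2
        · rw [← hT.2 i (by omega)]
          congr 1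
          ext x
          constructor
          · intro hx
            obtain ⟨h1, h2⟩ := mem_filter.1 hx
            rw [restrict_apply T hs.le h1] at h2
            exact mem_filter.2 ⟨(mem_filter.1 h1).1, h2⟩
          · intro hx
            obtain ⟨h1, h2⟩ := mem_filter.1 hx
            have h3 : x ∈ (sublevel T r).cells := mem_filter.2 ⟨h1, by omega⟩
            exact mem_filter.2 ⟨h3, by rw [restrict_apply T hs.le h3, h2]⟩
      · intro T hT T' hT' e
        obtain ⟨hT, hk⟩ := mem_filter.1 hT
        obtain ⟨hT', hk'⟩ := mem_filter.1 hT'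
        refine SemistandardYoungTableau.ext fun i j => ?_
        by_cases h1 : (i, j) ∈ kap
        · rw [← restrict_apply T hs.le h1, ← restrict_apply T' hs.le h1, e]
        · by_cases h2 : (i, j) ∈ lam
          · rw [hfib T hT (i, j) (mem_sdiff.2 ⟨h2, by rwa [hk]⟩),
              hfib T' hT' (i, j) (mem_sdiff.2 ⟨h2, by rwa [hk']⟩)]
          · rw [T.zeros h2, T'.zeros h2]
      · intro T hT
        rw [mem_letterTableaux] at hT
        have hsub : kap.cells ⊆ lam.cells := YoungDiagram.cells_subset_iff.2 hs.le
        have hin : ∀ x ∈ kap.cells, extend T hs r hT.1 x.1 x.2 = T x.1 x.2 := fun x hx => if_pos hx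
        have hout : ∀ x ∈ lam.cells, x ∉ kap.cells → extend T hs r hT.1 x.1 x.2 = r :=
          fun x hx hx' => (if_neg hx').trans (if_pos hx)
        refine ⟨extend T hs r hT.1, mem_filter.2 ⟨mem_letterTableaux.2 ⟨?_, ?_⟩, ?_⟩, ?_⟩
        · intro x hx
          by_cases hk : x ∈ kap.cells
          · rw [hin x hk]
            exact (hT.1 x hk).trans (Nat.lt_succ_self r)
          · rw [hout x hx hk]
            exact Nat.lt_succ_self r
        · intro i hi
          rcases Nat.lt_succ_iff_lt_or_eq.1 hi with hi | rfl
          · rw [← hT.2 i hi]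
            congr 1
            ext x
            rw [mem_filter, mem_filter]
            constructor
            · rintro ⟨h1, h2⟩
              by_cases hk : x ∈ kap.cells
              · exact ⟨hk, by rw [← hin x hk, h2]⟩
              · rw [hout x h1 hk] at h2
                omega
            · rintro ⟨h1, h2⟩
              exact ⟨hsub h1, by rw [hin x h1, h2]⟩
          · have : (lam.cells.filter fun x => extend T hs i hT.1 x.1 x.2 = i)
                = lam.cells \ kap.cells := by
              ext x
              rw [mem_filter, mem_sdiff]
              refine and_congr_right fun h1 => ⟨fun h2 hk => ?_, hout x h1⟩
              have := hT.1 x hk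
              rw [hin x hk] at h2
              omega
            rw [this, card_sdiff_of_subset hsub]
            change lam.card - kap.card = _
            omega
        · refine YoungDiagram.ext ?_
          ext x
          change x ∈ lam.cells.filter _ ↔ _
          rw [mem_filter]
          constructor
          · rintro ⟨h1, h2⟩
            by_contra hk
            rw [hout x h1 hk] at h2
            exact lt_irrefl _ h2
          · intro h1
            exact ⟨hsub h1, by rw [hin x h1]; exact hT.1 x h1⟩
        · refine SemistandardYoungTableau.ext fun i j => ?_
          by_cases h1 : (i, j) ∈ kap
          · rw [restrict_apply _ hs.le h1]
            exact hin (i, j) h1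
          · rw [T.zeros h1, SemistandardYoungTableau.zeros _ h1]
      · intro T hT
        obtain ⟨h0, rfl⟩ := mem_filter.1 hT
        rw [← pow_add, tableauInv_eq_add T hs (fun x hx => (mem_filter.1 hx).2) (hfib T h0)]
    · intro T hT
      rw [mem_below]
      have hT' := mem_letterTableaux.1 hT
      refine ⟨fun i => ⟨?_, ?_⟩, ?_⟩
      · by_contra h
        have h1 : (i + 1, (sublevel T r).rowLen i) ∈ lam :=
          YoungDiagram.mem_iff_lt_rowLen.2 (not_le.1 h)
        have h2 : (i, (sublevel T r).rowLen i) ∈ lam := lam.up_left_mem (Nat.le_succ i) le_rfl h1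
        have h3 : T i ((sublevel T r).rowLen i) < T (i + 1) ((sublevel T r).rowLen i) :=
          T.col_strict (Nat.lt_succ_self i) h1
        have h4 : T (i + 1) ((sublevel T r).rowLen i) < r + 1 := hT'.1 _ h1
        have h5 : (i, (sublevel T r).rowLen i) ∈ sublevel T r :=
          mem_filter.2 ⟨h2, by change T i ((sublevel T r).rowLen i) < r; omega⟩
        exact lt_irrefl _ (YoungDiagram.mem_iff_lt_rowLen.1 h5)
      · by_contra h
        have h1 : (i, lam.rowLen i) ∈ sublevel T r :=
          YoungDiagram.mem_iff_lt_rowLen.2 (not_le.1 h)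
        have h2 : (i, lam.rowLen i) ∈ lam := (mem_filter.1 h1).1
        exact lt_irrefl _ (YoungDiagram.mem_iff_lt_rowLen.1 h2)
      · rw [← hT'.2 r (Nat.lt_succ_self r)]
        change (lam.cells.filter _).card + _ = lam.cells.card
        rw [← Finset.card_filter_add_card_filter_not (s := lam.cells) (fun x => T x.1 x.2 < r)]
        congr 2
        refine Finset.filter_congr fun x hx => ?_
        have := hT'.1 x hx
        omega

/-! ### Odd Kostka numbers -/

/-- The sign of the tableau of shape and content `λ`. -/
noncomputable def highestSign (lam : YoungDiagram) : ℤ :=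
  tableauSign (SemistandardYoungTableau.highestWeight lam)

theorem highestSign_mul_self (lam : YoungDiagram) : highestSign lam * highestSign lam = 1 := by
  rw [highestSign, tableauSign_eq, ← mul_pow]
  simp

/-- The odd Kostka number of a shape and a composition. -/
noncomputable def kostkaComp (lam : YoungDiagram) (alp : List ℕ) : ℤ :=
  highestSign lam * signedCount (alp.getD · 0) alp.length lam

theorem getD_rowLens (mu : YoungDiagram) (i : ℕ) : mu.rowLens.getD i 0 = mu.rowLen i := by
  rcases lt_or_ge i (mu.colLen 0) with h | h
  · simp [YoungDiagram.rowLens, h]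
  · rw [rowLen_eq_zero mu h, List.getD_eq_default]
    rwa [YoungDiagram.length_rowLens]

theorem tableaux_eq (lam mu : YoungDiagram) :
    tableaux lam mu = letterTableaux lam mu.rowLen (mu.colLen 0) := by
  ext T
  rw [mem_letterTableaux, tableaux, Set.Finite.mem_toFinset, Set.mem_ofPred_eq]
  constructor
  · intro h
    refine ⟨fun x hx => ?_, fun i _ => h i⟩
    by_contra h0
    have h1 := h (T x.1 x.2)
    rw [rowLen_eq_zero mu (not_lt.1 h0), Finset.card_eq_zero] at h1
    exact notMem_empty x (h1 ▸ mem_filter.2 ⟨hx, rfl⟩)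
  · rintro ⟨h1, h2⟩ i
    rcases lt_or_ge i (mu.colLen 0) with hi | hi
    · exact h2 i hi
    · rw [rowLen_eq_zero mu hi, Finset.card_eq_zero, Finset.filter_eq_empty_iff]
      intro x hx e
      have := h1 x hx
      omega

theorem kostka_eq_kostkaComp (lam mu : YoungDiagram) :
    kostka lam mu = kostkaComp lam mu.rowLens := by
  rw [kostka, kostkaComp, highestSign, tableaux_eq,
    Finset.sum_congr rfl fun T _ => tableauSign_eq T, sum_letterTableaux,
    YoungDiagram.length_rowLens]
  simp only [getD_rowLens]

theorem le_entry {lam : YoungDiagram} (T : SemistandardYoungTableau lam) {i j : ℕ}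
    (h : (i, j) ∈ lam) : i ≤ T i j := by
  induction i with
  | zero => exact Nat.zero_le _
  | succ i ih =>
    exact (ih (lam.up_left_mem (Nat.le_succ i) le_rfl h)).trans_lt
      (T.col_strict (Nat.lt_succ_self i) h)

theorem sum_entries {lam mu : YoungDiagram} {T : SemistandardYoungTableau lam}
    (hT : T ∈ tableaux lam mu) : ∑ x ∈ lam.cells, T x.1 x.2 = rowWeight mu := by
  rw [tableaux_eq, mem_letterTableaux] at hT
  rw [rowWeight_eq mu le_rfl, ← Finset.sum_fiberwise_of_maps_to
    (g := fun x : ℕ × ℕ => T x.1 x.2) (t := range (mu.colLen 0))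
    fun x hx => mem_range.2 (hT.1 x hx)]
  refine Finset.sum_congr rfl fun i hi => ?_
  rw [← hT.2 i (mem_range.1 hi), mul_comm, ← smul_eq_mul, ← Finset.sum_const]
  exact Finset.sum_congr rfl fun x hx => (mem_filter.1 hx).2

theorem highestWeight_content (lam : YoungDiagram) :
    HasContent (SemistandardYoungTableau.highestWeight lam) lam := by
  intro i
  rw [YoungDiagram.rowLen_eq_card]
  congr 1
  ext x
  rw [mem_filter, YoungDiagram.mem_row_iff]
  refine and_congr_right fun hx => ?_
  rw [SemistandardYoungTableau.highestWeight_apply, if_pos (show (x.1, x.2) ∈ lam from hx)]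

/-- Entries in row i are at least i, so their total w(μ) is at least w(λ), with equality only if
each entry equals its row number. This makes K unitriangular with respect to `rowWeight`, which
replaces the dominance order. -/
theorem eq_highestWeight {lam mu : YoungDiagram} {T : SemistandardYoungTableau lam}
    (hT : T ∈ tableaux lam mu) (h : rowWeight mu ≤ rowWeight lam) :
    T = SemistandardYoungTableau.highestWeight lam ∧ lam = mu := by
  have h1 : ∑ x ∈ lam.cells, x.1 = ∑ x ∈ lam.cells, T x.1 x.2 :=
    le_antisymm (Finset.sum_le_sum fun x hx => le_entry T hx) ((sum_entries hT).trans_le h)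
  have h2 := (Finset.sum_eq_sum_iff_of_le fun x hx => le_entry T hx).1 h1
  have hTe : T = SemistandardYoungTableau.highestWeight lam := by
    refine SemistandardYoungTableau.ext fun i j => ?_
    rw [SemistandardYoungTableau.highestWeight_apply]
    split_ifs with hc
    · exact (h2 (i, j) hc).symm
    · exact T.zeros hc
  refine ⟨hTe, diagram_ext fun i => ?_⟩
  have h3 : HasContent T mu := by simpa [tableaux] using hT
  rw [← highestWeight_content lam i, ← hTe, h3 i]

theorem kostka_self (lam : YoungDiagram) : kostka lam lam = 1 := by
  have h : tableaux lam lam = {SemistandardYoungTableau.highestWeight lam} := by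
    ext T
    rw [mem_singleton]
    constructor
    · exact fun hT => (eq_highestWeight hT le_rfl).1
    · rintro rfl
      simpa [tableaux] using highestWeight_content lam
  rw [kostka, h, sum_singleton]
  exact highestSign_mul_self lam

theorem kostka_eq_zero {lam mu : YoungDiagram} (h : rowWeight mu ≤ rowWeight lam) (hne : lam ≠ mu) :
    kostka lam mu = 0 := by
  rw [kostka, Finset.sum_eq_zero, mul_zero]
  exact fun T hT => absurd (eq_highestWeight hT h).2 hne

theorem exists_kostka_inverse :
    ∃ J : YoungDiagram → YoungDiagram → ℤ, ∀ n, ∀ lam ∈ partitions n, ∀ mu ∈ partitions n,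
      (∑ nu ∈ partitions n, kostka lam nu * J nu mu = if lam = mu then 1 else 0) ∧
      (∑ nu ∈ partitions n, J lam nu * kostka nu mu = if lam = mu then 1 else 0) := by
  have h : ∀ n, ∃ J : YoungDiagram → YoungDiagram → ℤ,
      ∀ lam ∈ partitions n, ∀ mu ∈ partitions n,
      (∑ nu ∈ partitions n, kostka lam nu * J nu mu = if lam = mu then 1 else 0) ∧
      (∑ nu ∈ partitions n, J lam nu * kostka nu mu = if lam = mu then 1 else 0) := by
    intro n
    let K : Matrix (partitions n) (partitions n) ℤ := fun lam mu => kostka lam mu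
    -- The blocks are the level sets of `rowWeight`, and each diagonal block is an identity matrix.
    have hK : K.BlockTriangular fun lam => rowWeight lam.1 := fun lam mu h =>
      kostka_eq_zero h.le fun e => h.ne' (congrArg rowWeight e)
    have hdet : K.det = 1 := by
      rw [hK.det]
      refine Finset.prod_eq_one fun a _ => ?_
      rw [show K.toSquareBlock (fun lam => rowWeight lam.1) a = 1 from ?_, Matrix.det_one]
      ext lam mu
      rw [Matrix.toSquareBlock_def, Matrix.of_apply, Matrix.one_apply]
      split_ifs with h
      · rw [h]
        exact kostka_self _
      · exact kostka_eq_zero (by rw [lam.2, mu.2]) fun e => h (Subtype.ext (Subtype.ext e))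
    have hunit : IsUnit K.det := by rw [hdet]; exact isUnit_one
    refine ⟨fun lam mu => if h : lam ∈ partitions n ∧ mu ∈ partitions n then
      K⁻¹ ⟨lam, h.1⟩ ⟨mu, h.2⟩ else 0, fun lam hlam mu hmu => ⟨?_, ?_⟩⟩
    · have h := congrFun (congrFun (Matrix.mul_nonsing_inv K hunit) ⟨lam, hlam⟩) ⟨mu, hmu⟩
      rw [Matrix.mul_apply, Matrix.one_apply] at h
      simp only [Subtype.mk.injEq] at h
      rw [← h, ← Finset.sum_coe_sort]
      refine Finset.sum_congr rfl fun nu _ => ?_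
      exact congrArg (kostka lam nu * ·) (dif_pos (And.intro nu.2 hmu))
    · have h := congrFun (congrFun (Matrix.nonsing_inv_mul K hunit) ⟨lam, hlam⟩) ⟨mu, hmu⟩
      rw [Matrix.mul_apply, Matrix.one_apply] at h
      simp only [Subtype.mk.injEq] at h
      rw [← h, ← Finset.sum_coe_sort]
      refine Finset.sum_congr rfl fun nu _ => ?_
      exact congrArg (· * kostka nu mu) (dif_pos (And.intro hlam nu.2))
  choose J hJ using h
  refine ⟨fun lam mu => J lam.card lam mu, fun n lam hlam mu hmu => ⟨?_, ?_⟩⟩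
  · rw [← (hJ n lam hlam mu hmu).1]
    exact Finset.sum_congr rfl fun nu hnu => by simp only [mem_partitions.1 hnu]
  · rw [← (hJ n lam hlam mu hmu).2]
    exact Finset.sum_congr rfl fun nu hnu => by simp only [mem_partitions.1 hlam]

theorem sum_getD (l : List ℕ) : ∑ i ∈ range l.length, l.getD i 0 = l.sum := by
  induction l with
  | nil => rfl
  | cons a l ih =>
    rw [List.length_cons, sum_range_succ', List.sum_cons, ← ih, add_comm]
    simp

theorem kostkaComp_eq_zero {lam : YoungDiagram} {alp : List ℕ} (h : lam.card ≠ alp.sum) :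
    kostkaComp lam alp = 0 := by
  rw [kostkaComp, signedCount_eq_zero, mul_zero]
  rwa [sum_getD]

/-- The signs of T_λ occur twice and cancel, so `cauchy_identity` applies to odd Kostka numbers of
arbitrary compositions. -/
theorem pairing_eq_sum (bet alp : List ℕ) :
    pairing bet alp = ∑ lam ∈ partitions alp.sum,
      (-1) ^ rowWeight lam * (kostkaComp lam bet * kostkaComp lam alp) := by
  by_cases h : bet.sum = alp.sum
  · rw [pairing_eq_matrixSum bet alp h, ← cauchy_identity, sum_getD]
    refine Finset.sum_congr rfl fun lam _ => ?_
    rw [kostkaComp, kostkaComp]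
    have := highestSign_mul_self lam
    linear_combination (-((-1) ^ rowWeight lam * signedCount (bet.getD · 0) bet.length lam
      * signedCount (alp.getD · 0) alp.length lam)) * this
  · rw [pairing, if_neg h, Finset.sum_eq_zero]
    intro lam hlam
    rw [mem_partitions] at hlam
    rw [kostkaComp_eq_zero (by omega : lam.card ≠ bet.sum)]
    ring

theorem pairing_comm (bet alp : List ℕ) : pairing bet alp = pairing alp bet := by
  by_cases h : bet.sum = alp.sum
  · rw [pairing_eq_sum, pairing_eq_sum, h]
    exact Finset.sum_congr rfl fun lam _ => by ring
  · rw [pairing, pairing, if_neg h, if_neg (Ne.symm h)]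

theorem angle_eq (lam : YoungDiagram) : angle lam = ∑ x ∈ lam.cells, (x.2 + 1) := by
  rw [sum_cells lam le_rfl (fun _ j => j + 1), angle, YoungDiagram.rowLens, List.map_map,
    sum_map_range]
  refine Finset.sum_congr rfl fun i _ => ?_
  have h := Finset.sum_range_succ' (fun j => j) (lam.rowLen i)
  rw [add_zero] at h
  rw [← h, Finset.sum_range_id, Nat.add_sub_cancel, mul_comm, Function.comp_apply]

/-- ⟨λ^T⟩ counts each cell with its one-based row number, so it is w(λ) + |λ|, and 2|λ| drops out of
the exponent. -/
theorem neg_one_pow_angle (lam : YoungDiagram) :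
    (-1 : ℤ) ^ (angle lam.transpose + lam.card) = (-1) ^ rowWeight lam := by
  have h : angle lam.transpose = rowWeight lam + lam.card := by
    have hc : lam.card = ∑ x ∈ lam.cells, 1 := by simp
    rw [angle_eq, rowWeight, hc, ← sum_add_distrib]
    refine Finset.sum_nbij' Prod.swap Prod.swap ?_ ?_ ?_ ?_ ?_
    · exact fun x hx => YoungDiagram.mem_transpose.1 hx
    · exact fun x hx => YoungDiagram.mem_transpose.2 hx
    all_goals intros; rfl
  rw [h, add_assoc, pow_add, ← two_mul, pow_mul]
  simp

/-! ### The form on odd symmetric functions -/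

section

variable (k : Type*) [CommRing k]

/-- The right side of `pairing_eq_sum` is symmetric in α and β. -/
theorem freeForm_comm (x y : FreeSym k) : freeForm k x y = freeForm k y x := by
  have h : freeForm k = (freeForm k).flip := by
    refine (FreeAlgebra.basisFreeMonoid k ℕ+).ext fun bet =>
      (FreeAlgebra.basisFreeMonoid k ℕ+).ext fun alp => ?_
    rw [LinearMap.flip_apply, basis_eq_hFreeProd, basis_eq_hFreeProd, freeForm_hFreeProd,
      freeForm_hFreeProd, pairing_comm]
  exact LinearMap.congr_fun (LinearMap.congr_fun h x) y

theorem form_comm (x y : OddSymFun k) : form k x y = form k y x := by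
  obtain ⟨x, rfl⟩ := Submodule.Quotient.mk_surjective _ x
  obtain ⟨y, rfl⟩ := Submodule.Quotient.mk_surjective _ y
  rw [form_mk, form_mk, freeForm_comm]

/-- An element that is orthogonal to all products of generators vanishes. -/
theorem eq_zero_of_form_eq_zero {z : OddSymFun k}
    (h : ∀ bet : List ℕ, (∀ a ∈ bet, 0 < a) → form k (hProd k bet) z = 0) : z = 0 := by
  obtain ⟨x, rfl⟩ := Submodule.Quotient.mk_surjective _ z
  have hx : (freeForm k).flip x = 0 := by
    refine (FreeAlgebra.basisFreeMonoid k ℕ+).ext fun bet => ?_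
    rw [basis_eq_hFreeProd]
    exact h _ fun a ha => by
      obtain ⟨b, -, rfl⟩ := List.mem_map.1 ha
      exact b.pos
  rw [Submodule.Quotient.mk_eq_zero]
  refine ⟨?_, hx⟩
  rw [SetLike.mem_coe, LinearMap.mem_ker]
  refine LinearMap.ext fun y => ?_
  rw [freeForm_comm]
  exact LinearMap.congr_fun hx y

theorem form_hProd {bet alp : List ℕ} (hb : ∀ a ∈ bet, 0 < a) (ha : ∀ a ∈ alp, 0 < a) :
    form k (hProd k bet) (hProd k alp) = ((pairing bet alp : ℤ) : k) := by
  have hlift : ∀ l : List ℕ, (∀ a ∈ l, 0 < a) → ∃ l' : List ℕ+, l'.map PNat.val = l := by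
    intro l
    induction l with
    | nil => exact fun _ => ⟨[], rfl⟩
    | cons a l ih =>
      intro h
      obtain ⟨l', hl'⟩ := ih fun b hb => h b (List.mem_cons_of_mem a hb)
      exact ⟨(⟨a, h a List.mem_cons_self⟩ : ℕ+) :: l', congrArg (a :: ·) hl'⟩
  obtain ⟨bet, rfl⟩ := hlift bet hb
  obtain ⟨alp, rfl⟩ := hlift alp ha
  exact freeForm_hFreeProd k bet alp

/-- `homogeneous` allows zero parts, while basis words have positive letters only; since h_0 = 1,
zeros can be deleted. -/
theorem exists_pos_hProd_eq (alp : List ℕ) :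
    ∃ bet : List ℕ, (∀ a ∈ bet, 0 < a) ∧ bet.sum = alp.sum ∧ hProd k bet = hProd k alp := by
  suffices h : ∃ bet : List ℕ, (∀ a ∈ bet, 0 < a) ∧ bet.sum = alp.sum ∧
      hFreeProd k bet = hFreeProd k alp by
    obtain ⟨bet, h1, h2, h3⟩ := h
    exact ⟨bet, h1, h2, by rw [hProd, hProd, h3]⟩
  induction alp with
  | nil => exact ⟨[], by simp, rfl, rfl⟩
  | cons a l ih =>
    obtain ⟨bet, h1, h2, h3⟩ := ih
    rcases Nat.eq_zero_or_pos a with rfl | ha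
    · refine ⟨bet, h1, by simpa using h2, ?_⟩
      rw [h3, hFreeProd, hFreeProd, List.map_cons, List.prod_cons]
      simp [hFree]
    · refine ⟨a :: bet, ?_, by simpa using h2, ?_⟩
      · simpa [ha] using h1
      · simp only [hFreeProd, List.map_cons, List.prod_cons] at h3 ⊢
        rw [h3]

theorem form_eq_zero_of_homogeneous {bet : List ℕ} (hb : ∀ a ∈ bet, 0 < a) {n : ℕ}
    (hn : bet.sum ≠ n) {z : OddSymFun k} (hz : z ∈ homogeneous k n) :
    form k (hProd k bet) z = 0 := by
  refine Submodule.span_induction ?_ ?_ ?_ ?_ hz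
  · rintro _ ⟨alp, rfl, rfl⟩
    obtain ⟨alp', h1, h2, h3⟩ := exists_pos_hProd_eq k alp
    rw [← h3, form_hProd k hb h1, pairing, if_neg (by rwa [h2]), Int.cast_zero]
  · exact map_zero _
  · intro x y _ _ hx hy
    rw [map_add, hx, hy, add_zero]
  · intro c x _ hx
    rw [map_smul, hx, smul_zero]

theorem rowLens_pos (mu : YoungDiagram) : ∀ a ∈ mu.rowLens, 0 < a := mu.pos_of_mem_rowLens

theorem sum_rowLens (mu : YoungDiagram) : mu.rowLens.sum = mu.card := by
  rw [card_eq_sum mu le_rfl, YoungDiagram.rowLens, sum_map_range]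

/-- The odd Schur functions, for a given inverse `J` of the odd Kostka matrices. -/
noncomputable def schurOf (J : YoungDiagram → YoungDiagram → ℤ) (lam : YoungDiagram) :
    OddSymFun k :=
  ∑ mu ∈ partitions lam.card, J mu lam • complete k mu

/-- The odd monomial functions, for a given inverse `J` of the odd Kostka matrices. -/
noncomputable def monomialOf (J : YoungDiagram → YoungDiagram → ℤ) (mu : YoungDiagram) :
    OddSymFun k :=
  ∑ lam ∈ partitions mu.card, (J mu lam * (-1) ^ rowWeight lam) • schurOf k J lam

/-- `J` consists of inverses of the odd Kostka matrices. -/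
def IsKostkaInverse (J : YoungDiagram → YoungDiagram → ℤ) : Prop :=
  ∀ n, ∀ lam ∈ partitions n, ∀ mu ∈ partitions n,
    (∑ nu ∈ partitions n, kostka lam nu * J nu mu = if lam = mu then 1 else 0) ∧
    (∑ nu ∈ partitions n, J lam nu * kostka nu mu = if lam = mu then 1 else 0)

variable {k} {J : YoungDiagram → YoungDiagram → ℤ}

/-- Expanding s_λ in the h_μ and applying the Cauchy identity, the product KJ = 1 leaves only the
term of λ. -/
theorem form_hProd_schurOf (hJ : IsKostkaInverse J) {bet : List ℕ} (hb : ∀ a ∈ bet, 0 < a)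
    (lam : YoungDiagram) :
    form k (hProd k bet) (schurOf k J lam)
      = (((-1) ^ rowWeight lam * kostkaComp lam bet : ℤ) : k) := by
  have h1 : ∀ mu ∈ partitions lam.card, form k (hProd k bet) (J mu lam • complete k mu)
      = ((∑ nu ∈ partitions lam.card,
          (-1) ^ rowWeight nu * kostkaComp nu bet * (kostka nu mu * J mu lam) : ℤ) : k) := by
    intro mu hmu
    rw [map_zsmul, complete, form_hProd k hb (rowLens_pos mu), pairing_eq_sum, sum_rowLens,
      mem_partitions.1 hmu, zsmul_eq_mul, ← Int.cast_mul, mul_sum]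
    congr 1
    exact Finset.sum_congr rfl fun nu _ => by rw [kostka_eq_kostkaComp]; ring
  rw [schurOf, map_sum, Finset.sum_congr rfl h1, ← Int.cast_sum, Finset.sum_comm]
  congr 1
  have hl : lam ∈ partitions lam.card := mem_partitions.2 rfl
  rw [Finset.sum_congr rfl fun nu hnu => by rw [← mul_sum, (hJ _ nu hnu lam hl).1],
    Finset.sum_eq_single_of_mem lam hl fun nu _ hne => by rw [if_neg hne, mul_zero],
    if_pos rfl, mul_one]

/-- Both sides have the same pairing with every h_β, and the form on Λ is nondegenerate. Here the
relations that hold in Λ but not in Λ' enter. -/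
theorem hProd_eq_sum_schurOf (hJ : IsKostkaInverse J) {alp : List ℕ} (ha : ∀ a ∈ alp, 0 < a) :
    hProd k alp = ∑ lam ∈ partitions alp.sum, kostkaComp lam alp • schurOf k J lam := by
  rw [← sub_eq_zero]
  refine eq_zero_of_form_eq_zero k fun bet hb => ?_
  rw [map_sub, form_hProd k hb ha, pairing_eq_sum, map_sum, Int.cast_sum, ← sum_sub_distrib]
  refine Finset.sum_eq_zero fun lam _ => ?_
  rw [map_zsmul, form_hProd_schurOf hJ hb, zsmul_eq_mul, ← Int.cast_mul, sub_eq_zero]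
  congr 1
  ring

theorem isOddSchur_schurOf (hJ : IsKostkaInverse J) : IsOddSchur (schurOf k J) := by
  intro n mu hmu
  rw [complete, hProd_eq_sum_schurOf hJ (rowLens_pos mu), sum_rowLens, mem_partitions.1 hmu]
  exact Finset.sum_congr rfl fun lam _ => by rw [kostka_eq_kostkaComp]

/-- The defining equations are solved by J; no linear independence is needed. -/
theorem IsOddSchur.eq_schurOf (hJ : IsKostkaInverse J) {s : YoungDiagram → OddSymFun k}
    (hs : IsOddSchur s) : s = schurOf k J := by
  funext lam
  have hl : lam ∈ partitions lam.card := mem_partitions.2 rfl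
  rw [schurOf, Finset.sum_congr rfl fun mu hmu => by rw [hs _ mu hmu, smul_sum], Finset.sum_comm]
  have h1 : ∀ nu ∈ partitions lam.card,
      ∑ mu ∈ partitions lam.card, J mu lam • kostka nu mu • s nu
        = if nu = lam then s lam else 0 := by
    intro nu hnu
    rw [Finset.sum_congr rfl fun mu _ => by rw [smul_smul, mul_comm], ← sum_smul,
      (hJ _ nu hnu lam hl).1]
    split_ifs with h
    · rw [h, one_smul]
    · rw [zero_smul]
  rw [Finset.sum_congr rfl h1, Finset.sum_ite_eq', if_pos hl]

theorem form_schurOf (hJ : IsKostkaInverse J) (lam mu : YoungDiagram) :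
    form k (schurOf k J lam) (schurOf k J mu)
      = if lam = mu then (-1) ^ rowWeight mu else 0 := by
  rw [form_comm]
  conv_lhs => rw [schurOf.eq_def k J lam]
  have h1 : ∀ nu ∈ partitions lam.card, form k (schurOf k J mu) (J nu lam • complete k nu)
      = (((-1) ^ rowWeight mu * (kostka mu nu * J nu lam) : ℤ) : k) := by
    intro nu _
    rw [map_zsmul, form_comm, complete, form_hProd_schurOf hJ (rowLens_pos nu), zsmul_eq_mul,
      ← Int.cast_mul, kostka_eq_kostkaComp]
    congr 1
    ring
  rw [map_sum, Finset.sum_congr rfl h1, ← Int.cast_sum, ← mul_sum]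
  have hl : lam ∈ partitions lam.card := mem_partitions.2 rfl
  by_cases hc : mu.card = lam.card
  · rw [(hJ _ mu (mem_partitions.2 hc) lam hl).1]
    by_cases h : lam = mu
    · simp [h]
    · simp [h, Ne.symm h]
  · rw [if_neg fun e => hc (by rw [e]), Finset.sum_eq_zero, mul_zero, Int.cast_zero]
    intro nu hnu
    rw [kostka_eq_kostkaComp, kostkaComp_eq_zero, zero_mul]
    rwa [sum_rowLens, mem_partitions.1 hnu]

theorem schurOf_mem_homogeneous (lam : YoungDiagram) :
    schurOf k J lam ∈ homogeneous k lam.card := by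
  refine Submodule.sum_mem _ fun mu hmu => zsmul_mem (Submodule.subset_span ?_) _
  exact ⟨mu.rowLens, by rw [sum_rowLens, mem_partitions.1 hmu], rfl⟩

theorem isOddMonomial_monomialOf (hJ : IsKostkaInverse J) : IsOddMonomial (monomialOf k J) := by
  intro n mu hmu
  obtain rfl := mem_partitions.1 hmu
  refine ⟨Submodule.sum_mem _ fun lam hlam => zsmul_mem ?_ _, fun lam hlam => ?_⟩
  · rw [← mem_partitions.1 hlam]
    exact schurOf_mem_homogeneous lam
  · have h1 : ∀ nu ∈ partitions mu.card,
        form k (complete k lam) ((J mu nu * (-1) ^ rowWeight nu) • schurOf k J nu)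
          = ((J mu nu * kostka nu lam : ℤ) : k) := by
      intro nu _
      rw [map_zsmul, complete, form_hProd_schurOf hJ (rowLens_pos lam), zsmul_eq_mul,
        ← Int.cast_mul, kostka_eq_kostkaComp]
      congr 1
      have hsq : (-1 : ℤ) ^ rowWeight nu * (-1) ^ rowWeight nu = 1 := by
        rw [← mul_pow]; simp
      linear_combination (J mu nu * kostkaComp nu lam.rowLens) * hsq
    rw [monomialOf, map_sum, Finset.sum_congr rfl h1, ← Int.cast_sum, (hJ _ mu hmu lam hlam).2]
    by_cases h : lam = mu
    · simp [h]
    · simp [h, Ne.symm h]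

/-- By `hProd_eq_sum_schurOf` every h_β of degree n is a combination of the s_λ, hence of the h_λ
with λ ⊢ n. Products of other degrees are orthogonal to Λ_n. -/
theorem eq_zero_of_form_complete_eq_zero (hJ : IsKostkaInverse J) {n : ℕ} {z : OddSymFun k}
    (hz : z ∈ homogeneous k n) (h : ∀ lam ∈ partitions n, form k (complete k lam) z = 0) :
    z = 0 := by
  refine eq_zero_of_form_eq_zero k fun bet hb => ?_
  by_cases hn : bet.sum = n
  · have hs : ∀ lam ∈ partitions n, form k z (schurOf k J lam) = 0 := by
      intro lam hlam
      rw [schurOf, map_sum, mem_partitions.1 hlam]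
      refine Finset.sum_eq_zero fun mu hmu => ?_
      rw [map_zsmul, form_comm, h mu hmu, smul_zero]
    rw [form_comm, hProd_eq_sum_schurOf hJ hb, map_sum, hn]
    exact Finset.sum_eq_zero fun lam hlam => by rw [map_zsmul, hs lam hlam, smul_zero]
  · exact form_eq_zero_of_homogeneous k hb hn hz

theorem IsOddMonomial.eq_monomialOf (hJ : IsKostkaInverse J) {m : YoungDiagram → OddSymFun k}
    (hm : IsOddMonomial m) : m = monomialOf k J := by
  funext mu
  have hmu : mu ∈ partitions mu.card := mem_partitions.2 rfl
  obtain ⟨h1, h2⟩ := hm _ mu hmu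
  obtain ⟨h3, h4⟩ := isOddMonomial_monomialOf (k := k) hJ _ mu hmu
  rw [← sub_eq_zero]
  refine eq_zero_of_form_complete_eq_zero hJ (Submodule.sub_mem _ h1 h3) fun lam hlam => ?_
  rw [map_sub, h2 lam hlam, h4 lam hlam, sub_self]

/-- `monomialOf` applies J to the signed Schur functions, and K undoes this. -/
theorem schurOf_eq_sum_monomialOf (hJ : IsKostkaInverse J) {n : ℕ} {lam : YoungDiagram}
    (hlam : lam ∈ partitions n) :
    ((-1 : ℤ) ^ rowWeight lam) • schurOf k J lam
      = ∑ mu ∈ partitions n, kostka lam mu • monomialOf k J mu := by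
  have h1 : ∀ mu ∈ partitions n, kostka lam mu • monomialOf k J mu
      = ∑ nu ∈ partitions n,
          (kostka lam mu * J mu nu) • ((-1 : ℤ) ^ rowWeight nu) • schurOf k J nu := by
    intro mu hmu
    rw [monomialOf, smul_sum, mem_partitions.1 hmu]
    exact Finset.sum_congr rfl fun nu _ => by rw [smul_smul, smul_smul, mul_assoc]
  rw [Finset.sum_congr rfl h1, Finset.sum_comm]
  rw [Finset.sum_congr rfl fun nu hnu => by rw [← sum_smul, (hJ _ lam hlam nu hnu).1],
    Finset.sum_eq_single_of_mem lam hlam fun nu _ hne => by rw [if_neg hne.symm, zero_smul],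
    if_pos rfl, one_smul]

end

end OddSym

theorem mainTheorem2 (k : Type*) [CommRing k] :
    (∃! s : YoungDiagram → OddSym.OddSymFun k, OddSym.IsOddSchur s) ∧
    (∃! m : YoungDiagram → OddSym.OddSymFun k, OddSym.IsOddMonomial m) ∧
    ∀ s : YoungDiagram → OddSym.OddSymFun k, OddSym.IsOddSchur s →
      (∀ lam mu : YoungDiagram, OddSym.form k (s lam) (s mu) =
        if lam = mu then (-1) ^ (OddSym.angle lam.transpose + lam.card) else 0) ∧
      ∀ m : YoungDiagram → OddSym.OddSymFun k, OddSym.IsOddMonomial m →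
        ∀ (n : ℕ), ∀ lam ∈ OddSym.partitions n,
          ((-1 : ℤ) ^ (OddSym.angle lam.transpose + lam.card)) • s lam =
            ∑ mu ∈ OddSym.partitions n, OddSym.kostka lam mu • m mu := by
  obtain ⟨J, hJ⟩ := OddSym.exists_kostka_inverse
  refine ⟨⟨_, OddSym.isOddSchur_schurOf hJ, fun s hs => hs.eq_schurOf hJ⟩,
    ⟨_, OddSym.isOddMonomial_monomialOf hJ, fun m hm => hm.eq_monomialOf hJ⟩, fun s hs => ?_⟩
  obtain rfl := hs.eq_schurOf hJ
  refine ⟨fun lam mu => ?_, fun m hm n lam hlam => ?_⟩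
  · rw [OddSym.form_schurOf hJ]
    split_ifs with h
    · have h1 := congrArg (Int.cast : ℤ → k) (OddSym.neg_one_pow_angle lam)
      push_cast at h1
      rw [h1, h]
    · rfl
  · obtain rfl := hm.eq_monomialOf hJ
    rw [OddSym.neg_one_pow_angle, OddSym.schurOf_eq_sum_monomialOf hJ hlam]
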